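/- Let $x>0$ be real. For complex $r,s,t$ with $\Re(r+t)>1$, $\Re(s+t)>1$, $\Re(r+s+t)>2$ put $$\Theta(r,s,t,x)=\sum_{n=1}^{\infty}\sum_{m=1}^{\infty}\frac{1}{n^{r}m^{s}(n+mx)^{t}},$$ an absolutely convergent series. Let $r\le 0$ be an integer and let $\ell\ge 0$ be an integer with $\ell\ge 1-r$. For each fixed $s\in\mathbb{C}$, the function $t\mapsto\Theta(r,s,t,x)$ extends uniquely to a meromorphic function on $\mathbb{C}$ (with removable singularities filled in), again denoted $\Theta(r,s,t,x)$. Write $t_0=1-r-\ell$, and let $H_n=\sum_{j=1}^n 1/j$ ($H_0=0$), $\gamma$ be Euler's constant and $\zeta$ the Riemann zeta function. Then, as $t\to t_0$ (with constants in $O$ that may depend on $r,s,\ell,x$): **Case I.** If $s\in\mathbb{C}\setminus\mathbb{Z}$, or if $s\in\mathbb{Z}$, $s>r+\ell$ and $s\neq\ell+1$, then $$\Theta(r,s,t,x)=(-1)^{r-1}\frac{(r+\ell-1)!}{\ell!}x^{\ell}\,\Gamma(1-r)\,\zeta(s-\ell)+\sum_{k=0}^{r+\ell-1}\frac{(r+\ell-1)!\,\zeta(r-k)}{x^{1-r-\ell+k}\,k!\,(r+\ell-k-1)!}\,\zeta(-r+s-\ell+k+1)+O(|t-t_0|).$$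 **Case II.** If $s=\ell+1$ (so that $s>r+\ell$), then $$\Theta(r,s,t,x)=(-1)^{r-1}(-r)!\,x^{\ell}\frac{(r+\ell-1)!}{\ell!\,(t-t_0)}+(-1)^{r-1}(-r)!\,x^{\ell}\frac{(r+\ell-1)!}{\ell!}\bigl(\gamma-\log x+H_{\ell}-H_{r+\ell-1}\bigr)+\sum_{k=0}^{r+\ell-1}\binom{r+\ell-1}{k}\frac{\zeta(r-k)}{x^{k-r-\ell+1}}\,\zeta(k-r+2)+O(|t-t_0|).$$ **Case III.** If $s\le 0$ is an integer (so that $s\le r+\ell$), then $$\Theta(r,s,t,x)=(-1)^{r-1}x^{\ell}\frac{(-r)!\,(r+\ell-1)!}{\ell!}\zeta(s-\ell)+\sum_{k=0}^{r+\ell-1}\frac{\zeta(r-k)\,(r+\ell-1)!}{x^{k-r-\ell+1}\,k!\,(r+\ell-k-1)!}\,\zeta(s+1-r-\ell+k)+(-1)^{s-1}x^{s-1}\frac{(r+\ell-1)!\,(-s)!}{(r+\ell-s)!}\zeta(s-\ell)+O(|t-t_0|).$$ **Case IV.** If $s$ is an integer with $1\le s\le r+\ell$, then $$\Theta(r,s,t,x)=x^{s-1}\frac{(r+\ell-1)!}{(r+\ell-s)!\,(s-1)!}\,\frac{\zeta(s-\ell)}{t-t_0}+x^{s-1}\frac{(r+\ell-1)!}{(r+\ell-s)!\,(s-1)!}\bigl(\gamma-H_{r+\ell-1}+H_{s-1}-\log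 x\bigr)\zeta(s-\ell)-(-1)^{r}x^{\ell}\frac{(-r)!\,(r+\ell-1)!}{\ell!}\zeta(s-\ell)+\sum_{\substack{k=0\\k\ne r+\ell-s}}^{r+\ell-1}\frac{(r+\ell-1)!\,\zeta(r-k)}{(r+\ell-k-1)!\,x^{k-r-\ell+1}\,k!}\,\zeta(s-r-\ell+k+1)+O(|t-t_0|).$$ In Cases I and III the estimate holds on a full neighbourhood of $t_0$, so that $\Theta(r,s,\cdot,x)$ has no pole at $t_0$. -/

import Mathlib

open Filter Topology

/-- The region of all `(r, s, t)` with `Re (r + t) > 1`, `Re (s + t) > 1` and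
`Re (r + s + t) > 2`, in which the Mordell-Tornheim series converges absolutely. -/
def mtRegion : Set (ℂ × ℂ × ℂ) :=
  {p | 1 < (p.1 + p.2.2).re ∧ 1 < (p.2.1 + p.2.2).re ∧ 2 < (p.1 + p.2.1 + p.2.2).re}

/-- The general term `1 / (n ^ r * m ^ s * (n + m x) ^ t)` of the double series, with
`p = (n, m)` a pair of positive integers. -/
noncomputable def mtTerm (r s t : ℂ) (x : ℝ) (p : ℕ+ × ℕ+) : ℂ :=
  1 / ((p.1 : ℂ) ^ r * (p.2 : ℂ) ^ s * ((p.1 : ℂ) + (p.2 : ℂ) * (x : ℂ)) ^ t)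

/-- `Θ` is the function `t ↦ Θ(r, s, t, x)`, for fixed `r`, `s`, `x`: it is meromorphic on the
whole plane and is the sum of the double series wherever `(r, s, t)` is in the region of absolute
convergence. Normal form means that removable singularities are filled in (and that the value at
a pole is `0`), so that `Θ` is determined as a function. -/
def IsMordellTornheim (r s : ℂ) (x : ℝ) (Θ : ℂ → ℂ) : Prop :=
  MeromorphicNFOn Θ Set.univ ∧
    ∀ t : ℂ, (r, s, t) ∈ mtRegion → HasSum (mtTerm r s t x) (Θ t)

/-- The factorial `n!` of an integer `n ≥ 0`, as a complex number (used for `n ≥ 0` only). -/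
noncomputable def factZ (n : ℤ) : ℂ := (n.toNat.factorial : ℂ)

/-- The harmonic number `H_n = 1 + 1/2 + ⋯ + 1/n` of an integer `n ≥ 0`, with `H_0 = 0`, as a
complex number (used for `n ≥ 0` only). -/
noncomputable def harmZ (n : ℤ) : ℂ := ((harmonic n.toNat : ℚ) : ℂ)

/-- Euler's constant as a complex number. -/
noncomputable def eulerC : ℂ := (Real.eulerMascheroniConstant : ℂ)

/-- The complex number `log x` for real `x` (used for `x > 0` only). -/
noncomputable def logC (x : ℝ) : ℂ := (Real.log x : ℂ)

/-- The centre `t₀ = 1 - r - ℓ` of the expansions. -/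
noncomputable def mtCentre (r : ℤ) (ℓ : ℕ) : ℂ := 1 - (r : ℂ) - (ℓ : ℂ)

/-!
Write `r = -a` and `ℓ = N + a + 1`, so that the centre is `t₀ = -N`. For `r = 0` the sum over `n`
of `(n + y) ^ (-t)`, `y = m x`, is expanded by Euler-Maclaurin; summing the boundary terms
over `m` gives zeta values at `s + t + k`, with coefficients that are binomial coefficients of `-t`
times `ζ(-k)` times powers of `x`, and the leading integral gives `ζ(s + t - 1)`
(`euler_maclaurin_cpow`, `hasSum_mtTerm_zero`). The remainder of order `K` is a double series with
terms of size `(n + m) ^ (-Re t - K) * m ^ (-Re s)`, so it is holomorphic in `t` in a half-plane that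
grows with `K`; and it carries the factor `t (t + 1) ⋯ (t + K - 1)`, so it vanishes at `-N` for
`N < K`.

The general case follows from `n = (n + m x) - m x`, which gives
`Θ(r - 1, s, t) = Θ(r, s, t - 1) - x Θ(r, s - 1, t)`. The explicit parts `mtMain` obey the same
recursion by Pascal's rule (`mtMain_succ`), and so do the remainders; this is `exists_remainder`.
Letting `K` grow and using the identity theorem gives existence and uniqueness of the continuation
(`exists_isMordellTornheim`, `IsMordellTornheim.unique`).

Near `-N` only the explicit part matters up to `O(t - t₀)` (`IsMordellTornheim.isBigO_sub`). At
most one of its zeta factors has a pole at `-N`. None has one in Case I; it is the factor of the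
leading term in Case II, the factor with index `k = N + 1 - s > N` in Case III, where the zero of
the binomial coefficient cancels the pole, and the factor with index `k = N + 1 - s ≤ N` in
Case IV. Then `A(t) ζ(1 + t - t₀) = A(t₀) / (t - t₀) + A'(t₀) + γ A(t₀) + O(t - t₀)`, and the
logarithmic derivatives of the coefficients are differences of harmonic numbers minus `log x`.
-/

/-! ### Euler-Maclaurin on the unit interval -/

/-- The falling factorial `(-t)(-t-1)⋯(-t-k+1)`, that is, `k!` times the binomial
coefficient `-t` over `k`. -/
noncomputable def fallNeg (t : ℂ) (k : ℕ) : ℂ := ∏ j ∈ Finset.range k, (-t - j)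

lemma fallNeg_succ (t : ℂ) (k : ℕ) : fallNeg t (k + 1) = fallNeg t k * (-t - k) :=
  Finset.prod_range_succ _ _

/-- The remainder of order `K` in the Euler-Maclaurin formula for `u ↦ (y + u) ^ (-t)` on the
unit interval. -/
noncomputable def emRem (K : ℕ) (t : ℂ) (y : ℝ) : ℂ :=
  (-1) ^ (K + 1) * fallNeg t K / (K.factorial : ℂ) *
    ∫ u in (0 : ℝ)..1, (bernoulliFun K u : ℂ) * ((y + u : ℝ) : ℂ) ^ (-t - K)

lemma hasDerivAt_shift_cpow (c : ℂ) {y u : ℝ} (h : 0 < y + u) :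
    HasDerivAt (fun u : ℝ => ((y + u : ℝ) : ℂ) ^ c) (c * ((y + u : ℝ) : ℂ) ^ (c - 1)) u := by
  have h1 := ((hasDerivAt_id ((y + u : ℝ) : ℂ)).cpow_const (c := c)
    (Or.inl (by simpa using h))).comp_ofReal
  simpa using h1.comp_const_add y u

lemma continuousOn_shift_cpow (c : ℂ) {y : ℝ} (hy : 0 < y) :
    ContinuousOn (fun u : ℝ => ((y + u : ℝ) : ℂ) ^ c) (Set.uIcc 0 1) := by
  intro u hu
  rw [Set.uIcc_of_le zero_le_one] at hu
  exact (hasDerivAt_shift_cpow c (by linarith [hu.1])).continuousAt.continuousWithinAt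

/-- Integration by parts against a Bernoulli polynomial. -/
lemma integral_bernoulliFun_mul_cpow (K : ℕ) (c : ℂ) {y : ℝ} (hy : 0 < y) :
    c * ∫ u in (0 : ℝ)..1, (bernoulliFun (K + 1) u : ℂ) * ((y + u : ℝ) : ℂ) ^ (c - 1) =
      (bernoulliFun (K + 1) 1 : ℂ) * ((y + 1 : ℝ) : ℂ) ^ c
        - (bernoulliFun (K + 1) 0 : ℂ) * (y : ℂ) ^ c
        - (K + 1) * ∫ u in (0 : ℝ)..1, (bernoulliFun K u : ℂ) * ((y + u : ℝ) : ℂ) ^ c := by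
  have hb : ∀ k : ℕ, Continuous (fun u : ℝ => (bernoulliFun k u : ℂ)) := fun k =>
    Complex.continuous_ofReal.comp (continuous_bernoulliFun k)
  have := intervalIntegral.integral_mul_deriv_eq_deriv_mul (a := (0 : ℝ)) (b := 1)
    (u := fun u : ℝ => (bernoulliFun (K + 1) u : ℂ))
    (v := fun u : ℝ => ((y + u : ℝ) : ℂ) ^ c)
    (u' := fun u : ℝ => ((K + 1 : ℕ) : ℂ) * (bernoulliFun K u : ℂ))
    (v' := fun u : ℝ => c * ((y + u : ℝ) : ℂ) ^ (c - 1))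
    (fun u _ => by
      have := (hasDerivAt_bernoulliFun (K + 1) u).ofReal_comp
      simpa using this)
    (fun u hu => by
      rw [Set.uIcc_of_le zero_le_one] at hu
      exact hasDerivAt_shift_cpow c (by linarith [hu.1]))
    ((continuous_const.mul (hb K)).intervalIntegrable _ _)
    ((continuousOn_const.mul (continuousOn_shift_cpow (c - 1) hy)).intervalIntegrable)
  simp only [add_zero] at this
  rw [← intervalIntegral.integral_const_mul, ← intervalIntegral.integral_const_mul]
  convert this using 2
  · ext u; ring
  · congr 1; ext u; push_cast; ring

lemma emRem_succ {K : ℕ} (hK : 1 ≤ K) (t : ℂ) {y : ℝ} (hy : 0 < y) :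
    emRem (K + 1) t y = emRem K t y + riemannZeta (-K) / K.factorial * fallNeg t K *
      (((y + 1 : ℝ) : ℂ) ^ (-t - K) - (y : ℂ) ^ (-t - K)) := by
  have h := integral_bernoulliFun_mul_cpow K (-t - K) hy
  -- The end values agree because `K + 1 ≠ 1`; the first order is treated in `emRem_one`.
  have h1 : bernoulliFun (K + 1) 1 = bernoulliFun (K + 1) 0 :=
    bernoulliFun_endpoints_eq_of_ne_one (by omega)
  rw [h1, bernoulliFun_eval_zero] at h
  have hK0 : ((K : ℂ) + 1) ≠ 0 := by exact_mod_cast Nat.succ_ne_zero K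
  have hf : (K.factorial : ℂ) ≠ 0 := by exact_mod_cast K.factorial_ne_zero
  have e : -t - ((K + 1 : ℕ) : ℂ) = -t - K - 1 := by push_cast; ring
  rw [emRem, emRem, fallNeg_succ, riemannZeta_neg_nat_eq_bernoulli, Nat.factorial_succ, e]
  push_cast at h ⊢
  rw [show ∀ I : ℂ, (-1 : ℂ) ^ (K + 1 + 1) * (fallNeg t K * (-t - K)) /
    ((K + 1) * K.factorial) * I = (-1) ^ (K + 1 + 1) * fallNeg t K /
    ((K + 1) * K.factorial) * ((-t - K) * I) from fun I => by ring, h]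
  field_simp
  ring

lemma emRem_one {t : ℂ} (ht : t ≠ 1) {y : ℝ} (hy : 0 < y) :
    emRem 1 t y = ((y + 1 : ℝ) : ℂ) ^ (-t)
      - ((y : ℂ) ^ (1 - t) - ((y + 1 : ℝ) : ℂ) ^ (1 - t)) / (t - 1)
      - 1 / 2 * (((y + 1 : ℝ) : ℂ) ^ (-t) - (y : ℂ) ^ (-t)) := by
  have h := integral_bernoulliFun_mul_cpow 0 (-t) hy
  have hI : ∫ u in (0 : ℝ)..1, (bernoulliFun 0 u : ℂ) * ((y + u : ℝ) : ℂ) ^ (-t) =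
      ((y : ℂ) ^ (1 - t) - ((y + 1 : ℝ) : ℂ) ^ (1 - t)) / (t - 1) := by
    have h1t : 1 - t ≠ 0 := sub_ne_zero.2 ht.symm
    have h1t' : t - 1 ≠ 0 := sub_ne_zero.2 ht
    have := intervalIntegral.integral_eq_sub_of_hasDerivAt (a := (0 : ℝ)) (b := 1)
      (f := fun u : ℝ => ((y + u : ℝ) : ℂ) ^ (1 - t) / (1 - t))
      (f' := fun u : ℝ => (bernoulliFun 0 u : ℂ) * ((y + u : ℝ) : ℂ) ^ (-t))
      (fun u hu => by
        rw [Set.uIcc_of_le zero_le_one] at hu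
        have := (hasDerivAt_shift_cpow (y := y) (u := u) (1 - t) (by linarith [hu.1])).div_const
          (1 - t)
        rw [mul_div_assoc, mul_div_cancel₀ _ h1t, show 1 - t - 1 = -t by ring] at this
        simpa [bernoulliFun_zero] using this)
      (by
        simp only [bernoulliFun_zero, Complex.ofReal_one, one_mul]
        exact (continuousOn_shift_cpow (-t) hy).intervalIntegrable)
    rw [this]
    simp only [add_zero]
    field_simp
    ring
  rw [hI] at h
  simp only [zero_add, bernoulliFun_one] at h
  have e : -t - ((1 : ℕ) : ℂ) = -t - 1 := by push_cast; ring
  rw [emRem, e, fallNeg_succ]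
  simp only [fallNeg, Finset.prod_range_zero, Nat.factorial_one, bernoulliFun_one]
  push_cast at h ⊢
  linear_combination h

/-- Euler-Maclaurin for `u ↦ (y + u) ^ (-t)` on the unit interval, solved for the value at the
right end; the Bernoulli numbers are written as values of `ζ` at the nonpositive integers. -/
lemma euler_maclaurin_cpow {K : ℕ} (hK : 1 ≤ K) {t : ℂ} (ht : t ≠ 1) {y : ℝ} (hy : 0 < y) :
    ((y + 1 : ℝ) : ℂ) ^ (-t) =
      ((y : ℂ) ^ (1 - t) - ((y + 1 : ℝ) : ℂ) ^ (1 - t)) / (t - 1)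
      + (∑ k ∈ Finset.range K, riemannZeta (-k) / k.factorial * fallNeg t k *
        ((y : ℂ) ^ (-t - k) - ((y + 1 : ℝ) : ℂ) ^ (-t - k)))
      + emRem K t y := by
  induction K, hK using Nat.le_induction with
  | base =>
    rw [emRem_one ht hy]
    simp [fallNeg, riemannZeta_zero]
    ring
  | succ K hK ih =>
    rw [emRem_succ hK t hy, Finset.sum_range_succ]
    linear_combination ih

/-! ### Convergence and bounds for the remainder -/

lemma norm_ofReal_cpow_le {c v w p₀ p₁ : ℝ} {z : ℂ} (hc : 0 < c) (hc1 : c ≤ 1) (hv : 1 ≤ v)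
    (hw : c * v ≤ w) (h0 : 0 ≤ p₀) (hz0 : p₀ ≤ -z.re) (hz1 : -z.re ≤ p₁) :
    ‖(w : ℂ) ^ z‖ ≤ c ^ (-p₁) * v ^ (-p₀) := by
  have hv0 : 0 < v := by linarith
  have hcv : 0 < c * v := by positivity
  rw [Complex.norm_cpow_eq_rpow_re_of_pos (hcv.trans_le hw)]
  calc w ^ z.re ≤ (c * v) ^ z.re := Real.rpow_le_rpow_of_nonpos hcv hw (by linarith)
    _ = c ^ z.re * v ^ z.re := Real.mul_rpow hc.le hv0.le
    _ ≤ c ^ (-p₁) * v ^ (-p₀) :=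
      mul_le_mul (Real.rpow_le_rpow_of_exponent_ge hc hc1 (by linarith))
        (Real.rpow_le_rpow_of_exponent_le hv (by linarith)) (by positivity) (by positivity)

lemma summable_pnat_rpow {α : ℝ} (hα : 1 < α) : Summable fun n : ℕ+ => ((n : ℕ) : ℝ) ^ (-α) :=
  (Real.summable_nat_rpow.2 (by linarith)).comp_injective PNat.coe_injective

/-- The factor `(n + m) ^ (-τ)` is split by `n + m ≥ n ^ θ * m ^ (1 - θ)` with a suitable `θ`. -/
lemma summable_add_rpow_mul_rpow {τ σ : ℝ} (hτ : 1 < τ) (hσ : 2 < σ + τ) :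
    Summable fun p : ℕ+ × ℕ+ =>
      (((p.1 : ℕ) : ℝ) + ((p.2 : ℕ) : ℝ)) ^ (-τ) * ((p.2 : ℕ) : ℝ) ^ (-σ) := by
  obtain ⟨α, h1, h2⟩ := exists_between (lt_min hτ (show 1 < σ + τ - 1 by linarith))
  obtain ⟨h2, h3⟩ := lt_min_iff.1 h2
  have := (summable_pnat_rpow h1).mul_of_nonneg
    (summable_pnat_rpow (α := σ + (τ - α)) (by linarith))
    (fun n => by positivity) (fun n => by positivity)
  refine Summable.of_nonneg_of_le (fun p => by positivity) (fun p => ?_) this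
  have hn : (0 : ℝ) < ((p.1 : ℕ) : ℝ) := by exact_mod_cast p.1.pos
  have hm : (0 : ℝ) < ((p.2 : ℕ) : ℝ) := by exact_mod_cast p.2.pos
  rw [show -τ = -α + -(τ - α) by ring, Real.rpow_add (by positivity),
    show -(σ + (τ - α)) = -(τ - α) + -σ by ring, Real.rpow_add hm, ← mul_assoc]
  refine mul_le_mul_of_nonneg_right (mul_le_mul ?_ ?_ (by positivity) (by positivity))
    (by positivity)
  · exact Real.rpow_le_rpow_of_nonpos hn (by linarith) (by linarith)
  · exact Real.rpow_le_rpow_of_nonpos hm (by linarith) (by linarith)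

lemma differentiable_fallNeg (k : ℕ) : Differentiable ℂ fun t => fallNeg t k := by
  unfold fallNeg
  fun_prop

lemma fallNeg_neg_natCast {N k : ℕ} (h : N < k) : fallNeg (-(N : ℂ)) k = 0 :=
  Finset.prod_eq_zero (Finset.mem_range.2 h) (by ring)

lemma differentiable_emRem (K : ℕ) {y : ℝ} (hy : 0 < y) :
    Differentiable ℂ fun t => emRem K t y := by
  intro t₀
  unfold emRem
  refine ((((differentiable_fallNeg K) t₀).const_mul _).div_const _).mul ?_
  have hb : Continuous (fun u : ℝ => (bernoulliFun K u : ℂ)) :=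
    Complex.continuous_ofReal.comp (continuous_bernoulliFun K)
  have hm : ∀ u ∈ Set.Icc (0 : ℝ) 1, ((y + u : ℝ) : ℂ) ∈ Complex.slitPlane := fun u hu =>
    Complex.ofReal_mem_slitPlane.2 (by linarith [hu.1])
  let F' : ℂ → ℝ → ℂ := fun t u => (bernoulliFun K u : ℂ) *
    (((y + u : ℝ) : ℂ) ^ (-t - K) * Complex.log ((y + u : ℝ) : ℂ) * (-1))
  have hc : Continuous fun u : ℝ => ((y + u : ℝ) : ℂ) := by fun_prop
  have hcont : ContinuousOn (fun q : ℂ × ℝ => F' q.1 q.2)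
      (Metric.closedBall t₀ 1 ×ˢ Set.Icc (0 : ℝ) 1) := by
    have h1 : ContinuousOn (fun q : ℂ × ℝ => ((y + q.2 : ℝ) : ℂ))
      (Metric.closedBall t₀ 1 ×ˢ Set.Icc (0 : ℝ) 1) := by fun_prop
    have h2 : ContinuousOn (fun q : ℂ × ℝ => -q.1 - (K : ℂ))
      (Metric.closedBall t₀ 1 ×ˢ Set.Icc (0 : ℝ) 1) := by fun_prop
    exact (hb.comp continuous_snd).continuousOn.mul
      (((h1.cpow h2 fun q hq => hm q.2 hq.2).mul
        (h1.clog fun q hq => hm q.2 hq.2)).mul continuousOn_const)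
  obtain ⟨C, hC⟩ := ((isCompact_closedBall t₀ 1).prod isCompact_Icc).exists_bound_of_continuousOn
    hcont
  have hF : ∀ t : ℂ, ContinuousOn
      (fun u : ℝ => (bernoulliFun K u : ℂ) * ((y + u : ℝ) : ℂ) ^ (-t - K)) (Set.uIcc 0 1) :=
    fun t => hb.continuousOn.mul (continuousOn_shift_cpow _ hy)
  have hsub : Set.uIoc (0 : ℝ) 1 ⊆ Set.Icc 0 1 := by
    rw [Set.uIoc_of_le zero_le_one]; exact Set.Ioc_subset_Icc_self
  refine (intervalIntegral.hasDerivAt_integral_of_dominated_loc_of_deriv_le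
    (F' := F') (bound := fun _ => C) (Metric.closedBall_mem_nhds t₀ one_pos)
    (Eventually.of_forall fun t => ?_) (hF t₀).intervalIntegrable ?_ ?_ ?_ ?_).2.differentiableAt
  · exact (intervalIntegrable_iff.1 (hF t).intervalIntegrable).aestronglyMeasurable
  · have : ContinuousOn (F' t₀) (Set.uIcc 0 1) := by
      rw [Set.uIcc_of_le zero_le_one]
      exact hcont.comp (f := fun u : ℝ => (t₀, u)) (by fun_prop)
        (fun u hu => ⟨Metric.mem_closedBall_self zero_le_one, hu⟩)
    exact (intervalIntegrable_iff.1 this.intervalIntegrable).aestronglyMeasurable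
  · exact Eventually.of_forall fun u hu t ht => hC (t, u) ⟨ht, hsub hu⟩
  · exact intervalIntegrable_const
  · refine Eventually.of_forall fun u hu t ht => ?_
    have h1 : HasDerivAt (fun t : ℂ => -t - (K : ℂ)) (-1) t :=
      ((hasDerivAt_id t).neg).sub_const _
    exact (h1.const_cpow (Or.inl (Complex.slitPlane_ne_zero (hm u (hsub hu))))).const_mul _

/-- A bound for the remainder whose dependence on `t` in a vertical strip is only through the
factor `fallNeg t K`. Here `y` is compared with `v ≥ 1` because `y` itself may be less than `1`. -/
lemma norm_emRem_le (K : ℕ) : ∃ B : ℝ, ∀ (c v y p₀ p₁ : ℝ) (t : ℂ), 0 < c → c ≤ 1 → 1 ≤ v →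
    c * v ≤ y → 0 ≤ p₀ → p₀ ≤ t.re + K → t.re + K ≤ p₁ →
    ‖emRem K t y‖ ≤ ‖fallNeg t K‖ * B * (c ^ (-p₁) * v ^ (-p₀)) := by
  obtain ⟨C, hC⟩ := (isCompact_Icc (a := (0 : ℝ)) (b := 1)).exists_bound_of_continuousOn
    (continuous_bernoulliFun K).continuousOn
  have hC0 : 0 ≤ C := (norm_nonneg _).trans (hC 0 (by simp))
  refine ⟨1 / (K.factorial : ℝ) * C, fun c v y p₀ p₁ t hc hc1 hv hy h0 h1 h2 => ?_⟩
  have hI : ‖∫ u in (0 : ℝ)..1, (bernoulliFun K u : ℂ) * ((y + u : ℝ) : ℂ) ^ (-t - K)‖ ≤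
      C * (c ^ (-p₁) * v ^ (-p₀)) * |1 - 0| := by
    refine intervalIntegral.norm_integral_le_of_norm_le_const fun u hu => ?_
    rw [Set.uIoc_of_le zero_le_one] at hu
    rw [norm_mul]
    refine mul_le_mul ?_ (norm_ofReal_cpow_le hc hc1 hv (by linarith [hu.1]) h0 ?_ ?_)
      (norm_nonneg _) hC0
    · rw [Complex.norm_real]; exact hC u ⟨hu.1.le, hu.2⟩
    · simp; linarith
    · simp; linarith
  rw [emRem, norm_mul, norm_div, norm_mul, norm_pow, norm_neg, norm_one, one_pow, one_mul,
    Complex.norm_natCast]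
  calc _ ≤ ‖fallNeg t K‖ / (K.factorial : ℝ) * (C * (c ^ (-p₁) * v ^ (-p₀)) * |1 - 0|) := by
        gcongr
    _ = _ := by simp; ring

/-! ### The remainder series -/

/-- The general term of the remainder series: the Euler-Maclaurin remainder on the interval
`[n - 1, n]`, weighted by `m ^ (-s)`. -/
noncomputable def remTerm (K : ℕ) (s t : ℂ) (x : ℝ) (p : ℕ+ × ℕ+) : ℂ :=
  (p.2 : ℂ) ^ (-s) * emRem K t ((p.2 : ℕ) * x + (p.1 : ℕ) - 1)

lemma min_mul_add_le {x : ℝ} (hx : 0 < x) (p : ℕ+ × ℕ+) :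
    min 1 x / 2 * (((p.1 : ℕ) : ℝ) + ((p.2 : ℕ) : ℝ)) ≤ ((p.2 : ℕ) : ℝ) * x + (p.1 : ℕ) - 1 := by
  have hn : (1 : ℝ) ≤ ((p.1 : ℕ) : ℝ) := by exact_mod_cast p.1.pos
  have hm : (1 : ℝ) ≤ ((p.2 : ℕ) : ℝ) := by exact_mod_cast p.2.pos
  have h1 := min_le_left 1 x
  have h2 := min_le_right 1 x
  have h0 : 0 < min 1 x := lt_min one_pos hx
  nlinarith [mul_nonneg (sub_nonneg.2 hn) (sub_nonneg.2 h1),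
    mul_nonneg (sub_nonneg.2 hm) h0.le, mul_nonneg (zero_le_one.trans hm) (sub_nonneg.2 h2)]

lemma shift_pos {x : ℝ} (hx : 0 < x) (p : ℕ+ × ℕ+) : 0 < ((p.2 : ℕ) : ℝ) * x + (p.1 : ℕ) - 1 := by
  have hn : (1 : ℝ) ≤ ((p.1 : ℕ) : ℝ) := by exact_mod_cast p.1.pos
  have hm : (0 : ℝ) < ((p.2 : ℕ) : ℝ) := by exact_mod_cast p.2.pos
  nlinarith [mul_pos hm hx]

lemma norm_pnat_cpow (m : ℕ+) (s : ℂ) : ‖(m : ℂ) ^ (-s)‖ = ((m : ℕ) : ℝ) ^ (-s.re) := by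
  rw [Complex.norm_natCast_cpow_of_pos m.pos, Complex.neg_re]

/-- A summable majorant of the remainder series, uniform in a vertical strip. -/
lemma exists_norm_remTerm_le (K : ℕ) (s : ℂ) {x : ℝ} (hx : 0 < x) (p₀ p₁ : ℝ) (h1 : 1 < p₀)
    (h2 : 2 < s.re + p₀) :
    ∃ u : ℕ+ × ℕ+ → ℝ, Summable u ∧ ∀ p t, p₀ ≤ t.re + K → t.re + K ≤ p₁ →
      ‖remTerm K s t x p‖ ≤ ‖fallNeg t K‖ * u p := by
  obtain ⟨B, hB⟩ := norm_emRem_le K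
  refine ⟨_, ((summable_add_rpow_mul_rpow h1 h2).mul_left (B * (min 1 x / 2) ^ (-p₁))),
    fun p t ht0 ht1 => ?_⟩
  have hn : (1 : ℝ) ≤ ((p.1 : ℕ) : ℝ) := by exact_mod_cast p.1.pos
  have hm : (0 : ℝ) ≤ ((p.2 : ℕ) : ℝ) := by positivity
  have h0 : 0 < min 1 x := lt_min one_pos hx
  have h := hB (min 1 x / 2) (((p.1 : ℕ) : ℝ) + ((p.2 : ℕ) : ℝ)) _ p₀ p₁ t (by positivity)
    (by linarith [min_le_left 1 x]) (by linarith) (min_mul_add_le hx p) (by linarith) ht0 ht1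
  rw [remTerm, norm_mul, norm_pnat_cpow]
  calc _ ≤ ((p.2 : ℕ) : ℝ) ^ (-s.re) * _ := mul_le_mul_of_nonneg_left h (by positivity)
    _ = _ := by ring

/-- A half-plane in which the remainder series of order `K` converges absolutely. -/
def remRegion (K : ℕ) (s : ℂ) : Set ℂ := {t | 1 < t.re + K ∧ 2 < (s + t).re + K}

lemma summable_remTerm {K : ℕ} {s t : ℂ} {x : ℝ} (hx : 0 < x) (ht : t ∈ remRegion K s) :
    Summable (remTerm K s t x) := by
  obtain ⟨h1, h2⟩ := ht
  obtain ⟨u, hu, h⟩ := exists_norm_remTerm_le K s hx (t.re + K) (t.re + K) h1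
    (by rw [Complex.add_re] at h2; linarith)
  exact Summable.of_norm_bounded (hu.mul_left _) fun p => h p t le_rfl le_rfl

lemma differentiableOn_tsum_remTerm (K : ℕ) (s : ℂ) {x : ℝ} (hx : 0 < x) :
    DifferentiableOn ℂ (fun t => ∑' p, remTerm K s t x p) (remRegion K s) := by
  intro t₀ ⟨h1, h2⟩
  rw [Complex.add_re] at h2
  obtain ⟨p₀, h3, h4⟩ := exists_between
    (max_lt h1 (show 2 - s.re < t₀.re + K by linarith))
  obtain ⟨h3, h5⟩ := max_lt_iff.1 h3
  obtain ⟨u, hu, h⟩ := exists_norm_remTerm_le K s hx p₀ (t₀.re + K + 1) h3 (by linarith)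
  obtain ⟨C, hC⟩ := (isCompact_closedBall t₀ 1).exists_bound_of_continuousOn
    (differentiable_fallNeg K).continuous.continuousOn
  let U : Set ℂ := Metric.ball t₀ 1 ∩ {t | p₀ < t.re + K}
  have hU : IsOpen U := Metric.isOpen_ball.inter
    (isOpen_lt continuous_const (Complex.continuous_re.add continuous_const))
  have := Complex.differentiableOn_tsum_of_summable_norm (F := fun p t => remTerm K s t x p)
    (U := U) (hu.abs.mul_left C) (fun p => ?_) hU (fun p t ht => ?_)
  · exact ((this t₀ ⟨Metric.mem_ball_self one_pos, h4⟩).differentiableAt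
      (hU.mem_nhds ⟨Metric.mem_ball_self one_pos, h4⟩)).differentiableWithinAt
  · exact ((differentiable_emRem K (shift_pos hx p)).const_mul _).differentiableOn
  · have hd : |t.re - t₀.re| < 1 := by
      rw [← Complex.sub_re]
      exact (Complex.abs_re_le_norm _).trans_lt (by simpa [dist_eq_norm] using ht.1)
    refine (h p t ht.2.le (by linarith [(abs_lt.1 hd).2])).trans ?_
    exact (mul_le_mul_of_nonneg_left (le_abs_self _) (norm_nonneg _)).trans
      (mul_le_mul_of_nonneg_right (hC t (Metric.ball_subset_closedBall ht.1)) (abs_nonneg _))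

/-! ### The case of `r = 0` -/

lemma hasSum_zeta_pnat {w : ℂ} (hw : 1 < w.re) :
    HasSum (fun m : ℕ+ => (m : ℂ) ^ (-w)) (riemannZeta w) := by
  have h1 : Summable fun n : ℕ => 1 / (n : ℂ) ^ w := Complex.summable_one_div_nat_cpow.2 hw
  have h2 : Summable fun m : ℕ+ => (m : ℂ) ^ (-w) := by
    refine (h1.comp_injective PNat.coe_injective).congr fun m => ?_
    simp [Complex.cpow_neg]
  have h3 := tsum_pnat_eq_tsum_succ (f := fun n : ℕ => (n : ℂ) ^ (-w))
  have h4 : riemannZeta w = ∑' m : ℕ+, (m : ℂ) ^ (-w) := by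
    rw [zeta_eq_tsum_one_div_nat_add_one_cpow hw, h3]
    simp [Complex.cpow_neg]
  exact h4 ▸ h2.hasSum

/-- The sum over `n ≥ 1` of `(y + n) ^ (-t)` without its Euler-Maclaurin remainder: the integral
over `[0, ∞)` and the first `K` boundary terms at `0`. -/
noncomputable def emMain (K : ℕ) (t : ℂ) (y : ℝ) : ℂ :=
  (y : ℂ) ^ (1 - t) / (t - 1) +
    ∑ k ∈ Finset.range K, riemannZeta (-k) / k.factorial * fallNeg t k * (y : ℂ) ^ (-t - k)

lemma tendsto_cpow_atTop_zero {c : ℂ} (hc : c.re < 0) (y : ℝ) :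
    Tendsto (fun n : ℕ => ((y + n : ℝ) : ℂ) ^ c) atTop (𝓝 0) := by
  rw [tendsto_zero_iff_norm_tendsto_zero]
  have h1 : Tendsto (fun n : ℕ => y + (n : ℝ)) atTop atTop :=
    tendsto_atTop_add_const_left _ _ tendsto_natCast_atTop_atTop
  have h2 := (tendsto_rpow_neg_atTop (y := -c.re) (by linarith)).comp h1
  refine h2.congr' ?_
  filter_upwards [h1.eventually_gt_atTop 0] with n hn
  rw [Complex.norm_cpow_eq_rpow_re_of_pos hn]
  simp

lemma tendsto_emMain (K : ℕ) {t : ℂ} (ht : 1 < t.re) (y : ℝ) :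
    Tendsto (fun n : ℕ => emMain K t (y + n)) atTop (𝓝 0) := by
  have h : Tendsto (fun n : ℕ => emMain K t (y + n)) atTop
      (𝓝 (0 / (t - 1) + ∑ k ∈ Finset.range K, riemannZeta (-k) / k.factorial * fallNeg t k * 0)) :=
    ((tendsto_cpow_atTop_zero (by simpa using ht) y).div_const _).add
      (tendsto_finsetSum _ fun k _ => (tendsto_cpow_atTop_zero (by
        simp only [Complex.sub_re, Complex.neg_re, Complex.natCast_re]
        have : (0 : ℝ) ≤ k := k.cast_nonneg
        linarith) y).const_mul _)
  simpa using h

lemma emMain_sub {K : ℕ} (hK : 1 ≤ K) {t : ℂ} (ht : t ≠ 1) {y : ℝ} (hy : 0 < y) :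
    emMain K t y - emMain K t (y + 1) = ((y + 1 : ℝ) : ℂ) ^ (-t) - emRem K t y := by
  rw [euler_maclaurin_cpow hK ht hy, emMain, emMain]
  simp only [mul_sub, Finset.sum_sub_distrib]
  ring

lemma hasSum_emMain {K : ℕ} (hK : 1 ≤ K) {t : ℂ} (ht : 1 < t.re) {y : ℝ} (hy : 0 < y)
    (hs : Summable fun n : ℕ+ => ((y + (n : ℕ) : ℝ) : ℂ) ^ (-t) - emRem K t (y + (n : ℕ) - 1)) :
    HasSum (fun n : ℕ+ => ((y + (n : ℕ) : ℝ) : ℂ) ^ (-t) - emRem K t (y + (n : ℕ) - 1))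
      (emMain K t y) := by
  have ht1 : t ≠ 1 := by rintro rfl; simp at ht
  rw [← Equiv.pnatEquivNat.symm.hasSum_iff]
  rw [← Equiv.pnatEquivNat.symm.summable_iff] at hs
  refine (hs.hasSum_iff_tendsto_nat).2 ?_
  have h : ∀ n : ℕ, ((fun n : ℕ+ => ((y + (n : ℕ) : ℝ) : ℂ) ^ (-t) - emRem K t (y + (n : ℕ) - 1)) ∘
      Equiv.pnatEquivNat.symm) n = emMain K t (y + n) - emMain K t (y + (n + 1 : ℕ)) := by
    intro n
    have := emMain_sub hK ht1 (y := y + n) (by positivity)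
    simp only [Function.comp_apply, Equiv.pnatEquivNat_symm_apply, Nat.succPNat_coe]
    rw [show y + ((n.succ : ℕ) : ℝ) - 1 = y + n by push_cast; ring,
      show y + ((n.succ : ℕ) : ℝ) = y + n + 1 by push_cast; ring, this]
  simp only [h, Finset.sum_range_sub']
  simpa using (tendsto_emMain K ht y).const_sub (emMain K t (y + (0 : ℕ)))

/-- The explicit part of the continuation of `Θ(-a, s, t, x)`: the contribution of the integral
and of the first `K` terms in the Euler-Maclaurin expansion of the sum over `n`. -/
noncomputable def mtMain (a K : ℕ) (s t : ℂ) (x : ℝ) : ℂ :=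
  (a.factorial : ℂ) / (∏ j ∈ Finset.range (a + 1), (t - (j + 1))) * (x : ℂ) ^ (a + 1 - t) *
      riemannZeta (s + t - a - 1)
    + ∑ k ∈ Finset.range K, riemannZeta (-a - k) * (fallNeg t k / k.factorial) *
      (x : ℂ) ^ (-t - k) * riemannZeta (s + t + k)

lemma pnat_mul_cpow {x : ℝ} (hx : 0 < x) (m : ℕ+) (s c : ℂ) :
    (m : ℂ) ^ (-s) * ((((m : ℕ) : ℝ) * x : ℝ) : ℂ) ^ c = (x : ℂ) ^ c * (m : ℂ) ^ (-(s - c)) := by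
  have hm : ((m : ℕ) : ℂ) ≠ 0 := by exact_mod_cast m.ne_zero
  rw [Complex.ofReal_mul, Complex.mul_cpow_ofReal_nonneg (Nat.cast_nonneg _) hx.le,
    show -(s - c) = -s + c by ring, Complex.cpow_add _ _ hm, Complex.ofReal_natCast]
  ring

lemma hasSum_emMain_zeta (K : ℕ) {s t : ℂ} {x : ℝ} (hx : 0 < x) (h : 2 < (s + t).re) :
    HasSum (fun m : ℕ+ => (m : ℂ) ^ (-s) * emMain K t ((m : ℕ) * x)) (mtMain 0 K s t x) := by
  have h1 := (hasSum_zeta_pnat (w := s + t - 1) (by simp at h ⊢; linarith)).mul_left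
    ((x : ℂ) ^ (1 - t) / (t - 1))
  have h2 := hasSum_sum (s := Finset.range K) fun k _ =>
    (hasSum_zeta_pnat (w := s + t + k) (by
      have : (0 : ℝ) ≤ k := k.cast_nonneg
      simp at h ⊢; linarith)).mul_left
    (riemannZeta (-k) / k.factorial * fallNeg t k * (x : ℂ) ^ (-t - k))
  have e1 : (fun m : ℕ+ => (m : ℂ) ^ (-s) * emMain K t ((m : ℕ) * x)) = fun m : ℕ+ =>
      (x : ℂ) ^ (1 - t) / (t - 1) * (m : ℂ) ^ (-(s + t - 1)) + ∑ k ∈ Finset.range K,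
        riemannZeta (-k) / k.factorial * fallNeg t k * (x : ℂ) ^ (-t - k) *
          (m : ℂ) ^ (-(s + t + k)) := by
    ext m
    rw [emMain, mul_add, Finset.mul_sum, show s + t - 1 = s - (1 - t) by ring]
    congr 1
    · linear_combination (1 / (t - 1)) * pnat_mul_cpow hx m s (1 - t)
    · refine Finset.sum_congr rfl fun k _ => ?_
      rw [show s + t + k = s - (-t - k) by ring]
      linear_combination (riemannZeta (-k) / k.factorial * fallNeg t k) *
        pnat_mul_cpow hx m s (-t - k)
  have e2 : mtMain 0 K s t x = (x : ℂ) ^ (1 - t) / (t - 1) * riemannZeta (s + t - 1) +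
      ∑ k ∈ Finset.range K, riemannZeta (-k) / k.factorial * fallNeg t k * (x : ℂ) ^ (-t - k) *
        riemannZeta (s + t + k) := by
    simp only [mtMain, Nat.factorial_zero, Nat.cast_one, Nat.cast_zero, zero_add,
      Finset.prod_range_one, neg_zero, zero_sub, sub_zero]
    congr 1
    · ring
    · exact Finset.sum_congr rfl fun k _ => by ring
  rw [e1, e2]
  exact h1.add h2

lemma mtTerm_zero (s t : ℂ) (x : ℝ) (p : ℕ+ × ℕ+) :
    mtTerm 0 s t x p =
      (p.2 : ℂ) ^ (-s) * ((((p.2 : ℕ) : ℝ) * x + (p.1 : ℕ) : ℝ) : ℂ) ^ (-t) := by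
  simp [mtTerm, Complex.cpow_neg, add_comm, mul_comm]

lemma summable_mtTerm_zero {s t : ℂ} {x : ℝ} (hx : 0 < x) (h1 : 1 < t.re) (h2 : 2 < (s + t).re) :
    Summable (mtTerm 0 s t x) := by
  rw [Complex.add_re] at h2
  have h0 : 0 < min 1 x := lt_min one_pos hx
  refine Summable.of_norm_bounded ((summable_add_rpow_mul_rpow h1 h2).mul_left
    ((min 1 x / 2) ^ (-t.re))) fun p => ?_
  have hn : (1 : ℝ) ≤ ((p.1 : ℕ) : ℝ) := by exact_mod_cast p.1.pos
  have hm : (0 : ℝ) ≤ ((p.2 : ℕ) : ℝ) := by positivity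
  rw [mtTerm_zero, norm_mul, norm_pnat_cpow]
  calc _ ≤ ((p.2 : ℕ) : ℝ) ^ (-s.re) * _ := mul_le_mul_of_nonneg_left
        (norm_ofReal_cpow_le (c := min 1 x / 2) (v := ((p.1 : ℕ) : ℝ) + ((p.2 : ℕ) : ℝ))
          (p₀ := t.re) (p₁ := t.re) (by positivity) (by linarith [min_le_left 1 x]) (by linarith)
          (by linarith [min_mul_add_le hx p]) (by linarith) (by simp) (by simp)) (by positivity)
    _ = _ := by ring

lemma hasSum_mtTerm_zero {K : ℕ} (hK : 1 ≤ K) {s t : ℂ} {x : ℝ} (hx : 0 < x) (h1 : 1 < t.re)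
    (h2 : 2 < (s + t).re) :
    HasSum (mtTerm 0 s t x) (mtMain 0 K s t x + ∑' p, remTerm K s t x p) := by
  have hr : Summable (remTerm K s t x) := summable_remTerm hx
    ⟨by have : (0 : ℝ) ≤ K := K.cast_nonneg
        linarith, by have : (0 : ℝ) ≤ K := K.cast_nonneg
                     linarith⟩
  have hd : Summable fun p => mtTerm 0 s t x p - remTerm K s t x p :=
    (summable_mtTerm_zero hx h1 h2).sub hr
  have hd' : Summable fun q : ℕ+ × ℕ+ => mtTerm 0 s t x q.swap - remTerm K s t x q.swap :=
    (Equiv.prodComm _ _).summable_iff.2 hd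
  have hf : ∀ m n : ℕ+, mtTerm 0 s t x (n, m) - remTerm K s t x (n, m) = (m : ℂ) ^ (-s) *
      (((((m : ℕ) : ℝ) * x + (n : ℕ) : ℝ) : ℂ) ^ (-t) -
        emRem K t (((m : ℕ) : ℝ) * x + (n : ℕ) - 1)) := fun m n => by
    rw [mtTerm_zero, remTerm, mul_sub]
  have hfib : ∀ m : ℕ+, HasSum (fun n : ℕ+ => mtTerm 0 s t x (m, n).swap -
      remTerm K s t x (m, n).swap) ((m : ℂ) ^ (-s) * emMain K t ((m : ℕ) * x)) := by
    intro m
    have hm : ((m : ℕ) : ℂ) ≠ 0 := by exact_mod_cast m.ne_zero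
    have hm' : (0 : ℝ) < ((m : ℕ) : ℝ) := by exact_mod_cast m.pos
    have hs := hd'.prod_factor m
    simp only [Prod.swap_prod_mk, hf] at hs ⊢
    refine (hasSum_emMain hK h1 (mul_pos hm' hx) ?_).mul_left _
    exact (summable_mul_left_iff (by rw [Complex.cpow_ne_zero_iff]; exact Or.inl hm)).1 hs
  have h3 := (hd'.hasSum.prod_fiberwise hfib).unique (hasSum_emMain_zeta K hx h2)
  have h4 : HasSum (fun p => mtTerm 0 s t x p - remTerm K s t x p) (mtMain 0 K s t x) := by
    rw [← h3]
    exact (Equiv.prodComm _ _).hasSum_iff.1 hd'.hasSum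
  simpa using h4.add hr.hasSum

/-! ### Descent in the first variable -/

lemma fallNeg_succ' (t : ℂ) (k : ℕ) : fallNeg t (k + 1) = -t * fallNeg (t + 1) k := by
  rw [fallNeg, Finset.prod_range_succ', mul_comm, fallNeg]
  congr 1
  · simp
  · exact Finset.prod_congr rfl fun j _ => by push_cast; ring

/-- Pascal's rule for the binomial coefficients of `-t`. -/
lemma fallNeg_pascal (t : ℂ) (k : ℕ) :
    fallNeg (t - 1) (k + 1) - fallNeg t (k + 1) = (k + 1) * fallNeg t k := by
  rw [fallNeg_succ', sub_add_cancel, fallNeg_succ]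
  ring

/-- The recursion `Θ(r - 1, s, t) = Θ(r, s, t - 1) - x Θ(r, s - 1, t)`, termwise: it comes from
`n = (n + m x) - m x`. -/
lemma mtTerm_succ (a : ℕ) (s t : ℂ) {x : ℝ} (hx : 0 < x) (p : ℕ+ × ℕ+) :
    mtTerm (-((a + 1 : ℕ) : ℂ)) s t x p =
      mtTerm (-(a : ℂ)) s (t - 1) x p - x * mtTerm (-(a : ℂ)) (s - 1) t x p := by
  have hn : ((p.1 : ℕ) : ℂ) ≠ 0 := by exact_mod_cast p.1.ne_zero
  have hm : ((p.2 : ℕ) : ℂ) ≠ 0 := by exact_mod_cast p.2.ne_zero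
  have hw : ((p.1 : ℕ) : ℂ) + ((p.2 : ℕ) : ℂ) * (x : ℂ) ≠ 0 := by
    have : (0 : ℝ) < ((p.1 : ℕ) : ℝ) + ((p.2 : ℕ) : ℝ) * x := by
      have := p.1.pos
      positivity
    exact_mod_cast this.ne'
  have h1 : ∀ c : ℂ, ((p.2 : ℕ) : ℂ) ^ c ≠ 0 := fun c => by
    rw [Complex.cpow_ne_zero_iff]; exact Or.inl hm
  have h2 : ∀ c : ℂ, (((p.1 : ℕ) : ℂ) + ((p.2 : ℕ) : ℂ) * (x : ℂ)) ^ c ≠ 0 := fun c => by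
    rw [Complex.cpow_ne_zero_iff]; exact Or.inl hw
  simp only [mtTerm]
  rw [Complex.cpow_sub _ _ hw, Complex.cpow_sub _ _ hm, Complex.cpow_neg, Complex.cpow_neg,
    Complex.cpow_natCast, Complex.cpow_natCast, Complex.cpow_one, Complex.cpow_one]
  have := h1 s
  have := h2 t
  field_simp
  ring

lemma prod_sub_ne_zero {a : ℕ} {t : ℂ} (h : 1 + a < t.re) :
    ∏ j ∈ Finset.range (a + 1), (t - (j + 1)) ≠ 0 := by
  refine Finset.prod_ne_zero_iff.2 fun j hj h0 => ?_
  have hj' : (j : ℝ) ≤ a := by exact_mod_cast Finset.mem_range_succ_iff.1 hj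
  have := congrArg Complex.re h0
  simp at this
  linarith

lemma mtMain_succ (a K : ℕ) (s : ℂ) {t : ℂ} {x : ℝ} (hx : 0 < x) (h : 1 + (a + 1 : ℕ) < t.re) :
    mtMain (a + 1) K s t x = mtMain a (K + 1) s (t - 1) x - x * mtMain a (K + 1) (s - 1) t x := by
  have hx' : (x : ℂ) ≠ 0 := by exact_mod_cast hx.ne'
  have hxc : ∀ c : ℂ, (x : ℂ) * (x : ℂ) ^ c = (x : ℂ) ^ (c + 1) := fun c => by
    rw [Complex.cpow_add _ _ hx', Complex.cpow_one, mul_comm]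
  have hP := prod_sub_ne_zero h
  have hP1 := Finset.prod_range_succ' (fun j : ℕ => t - ((j : ℂ) + 1)) (a + 1)
  have hP2 := Finset.prod_range_succ (fun j : ℕ => t - ((j : ℂ) + 1)) (a + 1)
  have hP3 : ∏ j ∈ Finset.range (a + 1), (t - (((j + 1 : ℕ) : ℂ) + 1)) =
      ∏ j ∈ Finset.range (a + 1), (t - 1 - ((j : ℂ) + 1)) :=
    Finset.prod_congr rfl fun j _ => by push_cast; ring
  rw [hP3] at hP1
  have hlead : ((a + 1).factorial : ℂ) / (∏ j ∈ Finset.range (a + 1 + 1), (t - (j + 1))) =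
      (a.factorial : ℂ) / (∏ j ∈ Finset.range (a + 1), (t - 1 - (j + 1))) -
      (a.factorial : ℂ) / (∏ j ∈ Finset.range (a + 1), (t - (j + 1))) := by
    have hA := hP1 ▸ hP
    have hB := hP2 ▸ hP
    have hA1 := left_ne_zero_of_mul hA
    have hB1 := left_ne_zero_of_mul hB
    rw [div_sub_div _ _ hA1 hB1, div_eq_div_iff hP (mul_ne_zero hA1 hB1), Nat.factorial_succ]
    push_cast at hP1 hP2 ⊢
    generalize ∏ j ∈ Finset.range (a + 1 + 1), (t - ((j : ℂ) + 1)) = P at *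
    generalize ∏ j ∈ Finset.range (a + 1), (t - ((j : ℂ) + 1)) = Q at *
    generalize ∏ j ∈ Finset.range (a + 1), (t - 1 - ((j : ℂ) + 1)) = R at *
    linear_combination (a.factorial : ℂ) * R * hP2 - (a.factorial : ℂ) * Q * hP1
  have hsum : ∑ k ∈ Finset.range K, riemannZeta (-((a + 1 : ℕ) : ℂ) - k) *
        (fallNeg t k / k.factorial) * (x : ℂ) ^ (-t - k) * riemannZeta (s + t + k) =
      ∑ k ∈ Finset.range (K + 1), riemannZeta (-a - k) * (fallNeg (t - 1) k / k.factorial) *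
        (x : ℂ) ^ (-(t - 1) - k) * riemannZeta (s + (t - 1) + k) -
      x * ∑ k ∈ Finset.range (K + 1), riemannZeta (-a - k) * (fallNeg t k / k.factorial) *
        (x : ℂ) ^ (-t - k) * riemannZeta (s - 1 + t + k) := by
    rw [Finset.mul_sum, ← Finset.sum_sub_distrib, Finset.sum_range_succ']
    have h0 : riemannZeta (-a - (0 : ℕ)) * (fallNeg (t - 1) 0 / (Nat.factorial 0 : ℕ)) *
        (x : ℂ) ^ (-(t - 1) - (0 : ℕ)) * riemannZeta (s + (t - 1) + (0 : ℕ)) -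
        x * (riemannZeta (-a - (0 : ℕ)) * (fallNeg t 0 / (Nat.factorial 0 : ℕ)) *
        (x : ℂ) ^ (-t - (0 : ℕ)) * riemannZeta (s - 1 + t + (0 : ℕ))) = 0 := by
      have := hxc (-t)
      rw [show -t + 1 = -(t - 1) by ring] at this
      simp only [Nat.cast_zero, sub_zero, add_zero, fallNeg, Finset.prod_range_zero,
        ← this, show s + (t - 1) = s - 1 + t by ring]
      ring
    rw [h0, add_zero]
    refine Finset.sum_congr rfl fun k _ => ?_
    have h1 := hxc (-t - ((k + 1 : ℕ) : ℂ))
    rw [show -t - ((k + 1 : ℕ) : ℂ) + 1 = -t - k by push_cast; ring] at h1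
    have h2 := fallNeg_pascal t k
    have hk : ((k : ℂ) + 1) ≠ 0 := by exact_mod_cast Nat.succ_ne_zero k
    have hf : (k.factorial : ℂ) ≠ 0 := by exact_mod_cast k.factorial_ne_zero
    rw [show s - 1 + t + ((k + 1 : ℕ) : ℂ) = s + t + k by push_cast; ring,
      show s + (t - 1) + ((k + 1 : ℕ) : ℂ) = s + t + k by push_cast; ring,
      show -(t - 1) - ((k + 1 : ℕ) : ℂ) = -t - k by push_cast; ring,
      show -((a + 1 : ℕ) : ℂ) - k = -a - ((k + 1 : ℕ) : ℂ) by push_cast; ring,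
      Nat.factorial_succ]
    have h3 : fallNeg t k / k.factorial =
        (fallNeg (t - 1) (k + 1) - fallNeg t (k + 1)) / (((k + 1) * k.factorial : ℕ) : ℂ) := by
      rw [h2]; push_cast; field_simp
    rw [h3]
    linear_combination (-riemannZeta (-a - ((k + 1 : ℕ) : ℂ)) * riemannZeta (s + t + k) *
      (fallNeg t (k + 1) / (((k + 1) * k.factorial : ℕ) : ℂ))) * (-h1)
  rw [mtMain, mtMain, mtMain, hsum, hlead]
  have h1 := hxc (a + 1 - t)
  rw [show (a : ℂ) + 1 - t + 1 = ((a + 1 : ℕ) : ℂ) + 1 - t by push_cast; ring] at h1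
  rw [show (a : ℂ) + 1 - (t - 1) = ((a + 1 : ℕ) : ℂ) + 1 - t by push_cast; ring,
    show s + t - ((a + 1 : ℕ) : ℂ) - 1 = s - 1 + t - a - 1 by push_cast; ring,
    show s + (t - 1) - a - 1 = s - 1 + t - a - 1 by ring, ← h1]
  ring

/-- The series for `Θ(-a, s, t, x)` is the explicit part plus a remainder, which is holomorphic
in a half-plane that grows with `K` and vanishes at the integers `-N` with `0 ≤ N < K`. -/
theorem exists_remainder (a : ℕ) {x : ℝ} (hx : 0 < x) : ∀ (s : ℂ) (K : ℕ), 1 ≤ K →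
    ∃ R : ℂ → ℂ, DifferentiableOn ℂ R (remRegion K s) ∧ (∀ N : ℕ, N < K → R (-N) = 0) ∧
      ∀ t : ℂ, 1 + a < t.re → 2 + a < (s + t).re →
        HasSum (mtTerm (-(a : ℂ)) s t x) (mtMain a K s t x + R t) := by
  induction a with
  | zero =>
    intro s K hK
    refine ⟨_, differentiableOn_tsum_remTerm K s hx, fun N hN => ?_, fun t h1 h2 => ?_⟩
    · simp [remTerm, emRem, fallNeg_neg_natCast hN]
    · simpa using hasSum_mtTerm_zero hK hx (by simpa using h1) (by simpa using h2)
  | succ a ih =>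
    intro s K hK
    obtain ⟨R₁, hd₁, hz₁, hs₁⟩ := ih s (K + 1) (by omega)
    obtain ⟨R₂, hd₂, hz₂, hs₂⟩ := ih (s - 1) (K + 1) (by omega)
    refine ⟨fun t => R₁ (t - 1) - x * R₂ t, ?_, fun N hN => ?_, fun t h1 h2 => ?_⟩
    · refine (hd₁.comp (by fun_prop) fun t ht => ?_).sub ((hd₂.mono fun t ht => ?_).const_mul _)
      · obtain ⟨h1, h2⟩ := ht
        simp only [remRegion, Set.mem_ofPred_eq, Complex.add_re, Complex.sub_re, Complex.one_re,
          Nat.cast_add, Nat.cast_one] at h1 h2 ⊢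
        constructor <;> linarith
      · obtain ⟨h1, h2⟩ := ht
        simp only [remRegion, Set.mem_ofPred_eq, Complex.add_re, Complex.sub_re, Complex.one_re,
          Nat.cast_add, Nat.cast_one] at h1 h2 ⊢
        constructor <;> linarith
    · have := hz₁ (N + 1) (by omega)
      rw [show -((N + 1 : ℕ) : ℂ) = -N - 1 by push_cast; ring] at this
      simp only [this, hz₂ N (by omega)]
      simp
    · have e : mtTerm (-((a + 1 : ℕ) : ℂ)) s t x = fun p =>
          mtTerm (-(a : ℂ)) s (t - 1) x p - x * mtTerm (-(a : ℂ)) (s - 1) t x p :=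
        funext (mtTerm_succ a s t hx)
      rw [e, mtMain_succ a K s hx h1]
      simp only [Nat.cast_add, Nat.cast_one, Complex.add_re] at h1 h2
      have := (hs₁ (t - 1) (by simp; linarith) (by simp; linarith)).sub
        ((hs₂ t (by linarith) (by simp; linarith)).mul_left (x : ℂ))
      rw [show ∀ A B C D : ℂ, A - x * B + (C - x * D) = A + C - x * (B + D) from
        fun A B C D => by ring]
      exact this

/-! ### Meromorphic continuation -/

lemma meromorphicAt_riemannZeta (z : ℂ) : MeromorphicAt riemannZeta z := by
  have h : MeromorphicAt (fun s : ℂ => (s - 1)⁻¹ + riemannZeta₀ s) z :=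
    ((MeromorphicAt.id z).sub (MeromorphicAt.const 1 z)).inv.add
      (differentiable_riemannZeta₀.analyticAt z).meromorphicAt
  refine h.congr ?_
  have hne : ∀ᶠ s in 𝓝[≠] z, s ≠ 1 :=
    (nhdsNE_le_cofinite z) (Set.finite_singleton (1 : ℂ)).eventually_cofinite_notMem
  filter_upwards [hne] with s hs
  exact (riemannZeta_eq_inv_sub_add hs).symm

lemma differentiable_ofReal_cpow {x : ℝ} (hx : 0 < x) {f : ℂ → ℂ} (hf : Differentiable ℂ f) :
    Differentiable ℂ fun t => (x : ℂ) ^ f t := fun t =>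
  (hf t).const_cpow (Or.inl (by exact_mod_cast hx.ne'))

lemma meromorphicAt_mtMain (a K : ℕ) (s : ℂ) {x : ℝ} (hx : 0 < x) (z : ℂ) :
    MeromorphicAt (fun t => mtMain a K s t x) z := by
  have hζ : ∀ f : ℂ → ℂ, Differentiable ℂ f → MeromorphicAt (fun t => riemannZeta (f t)) z :=
    fun f hf => (meromorphicAt_riemannZeta (f z)).comp_analyticAt (hf.analyticAt z)
  have hd : ∀ f : ℂ → ℂ, Differentiable ℂ f → MeromorphicAt f z :=
    fun f hf => (hf.analyticAt z).meromorphicAt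
  have h1 : Differentiable ℂ fun t : ℂ => ∏ j ∈ Finset.range (a + 1), (t - ((j : ℂ) + 1)) := by
    fun_prop
  have h2 := differentiable_ofReal_cpow hx (f := fun t => (a : ℂ) + 1 - t) (by fun_prop)
  have h3 := fun k : ℕ => differentiable_ofReal_cpow hx (f := fun t => -t - (k : ℂ)) (by fun_prop)
  refine ((((MeromorphicAt.const _ _).div (hd _ h1)).mul (hd _ h2)).mul
    (hζ (fun t => s + t - a - 1) (by fun_prop))).add (MeromorphicAt.fun_sum fun k _ => ?_)
  exact (((MeromorphicAt.const _ _).mul (hd _ ((differentiable_fallNeg k).div_const _))).mul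
    (hd _ (h3 k))).mul (hζ (fun t => s + t + k) (by fun_prop))

lemma isOpen_remRegion (K : ℕ) (s : ℂ) : IsOpen (remRegion K s) :=
  (isOpen_lt continuous_const (g := fun t : ℂ => t.re + K) (by fun_prop)).inter
    (isOpen_lt continuous_const (g := fun t : ℂ => (s + t).re + K) (by fun_prop))

lemma isPreconnected_remRegion (K : ℕ) (s : ℂ) : IsPreconnected (remRegion K s) := by
  have : remRegion K s = {t : ℂ | max (1 - K : ℝ) (2 - s.re - K) < t.re} := by
    ext t
    simp only [remRegion, Set.mem_ofPred_eq, max_lt_iff, Complex.add_re]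
    constructor <;> rintro ⟨h1, h2⟩ <;> constructor <;> linarith
  rw [this]
  exact (convex_halfSpace_re_gt _).isPreconnected

lemma exists_mem_remRegion (s t : ℂ) (K₀ : ℕ) : ∃ K, K₀ ≤ K ∧ t ∈ remRegion K s := by
  obtain ⟨K, hK⟩ := exists_nat_gt (max (1 - t.re) (2 - (s + t).re))
  obtain ⟨h1, h2⟩ := max_lt_iff.1 hK
  have h3 : (K : ℝ) ≤ (max K₀ K : ℕ) := by exact_mod_cast le_max_right _ _
  exact ⟨max K₀ K, le_max_left _ _, by constructor <;> linarith⟩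

/-- The identity theorem for meromorphic functions. -/
lemma MeromorphicOn.eventuallyEq_nhdsNE_of_isPreconnected {f g : ℂ → ℂ} {U : Set ℂ}
    (hf : MeromorphicOn f U) (hg : MeromorphicOn g U) (hU : IsPreconnected U) {z w : ℂ}
    (hz : z ∈ U) (hw : w ∈ U) (h : f =ᶠ[𝓝[≠] z] g) : f =ᶠ[𝓝[≠] w] g := by
  by_contra hne
  have h1 : meromorphicOrderAt (f - g) w ≠ ⊤ := by
    rw [Ne, meromorphicOrderAt_eq_top_iff]
    exact fun h0 => hne (h0.mono fun t ht => sub_eq_zero.1 ht)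
  refine (hf.sub hg).meromorphicOrderAt_ne_top_of_isPreconnected hU hw hz h1 ?_
  rw [meromorphicOrderAt_eq_top_iff]
  exact h.mono fun t ht => sub_eq_zero.2 ht

/-- The half-plane in which the series for `Θ(-a, s, t, x)` converges absolutely. -/
def convRegion (a : ℕ) (s : ℂ) : Set ℂ := {t | 1 + a < t.re ∧ 2 + a < (s + t).re}

lemma isOpen_convRegion (a : ℕ) (s : ℂ) : IsOpen (convRegion a s) :=
  (isOpen_lt continuous_const (g := fun t : ℂ => t.re) (by fun_prop)).inter
    (isOpen_lt continuous_const (g := fun t : ℂ => (s + t).re) (by fun_prop))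

lemma mem_mtRegion_iff {a : ℕ} {s t : ℂ} :
    (-(a : ℂ), s, t) ∈ mtRegion ↔ t ∈ convRegion a s := by
  have ha : (0 : ℝ) ≤ a := a.cast_nonneg
  simp only [mtRegion, convRegion, Set.mem_ofPred_eq, Complex.add_re, Complex.neg_re,
    Complex.natCast_re]
  constructor
  · rintro ⟨h1, h2, h3⟩; constructor <;> linarith
  · rintro ⟨h1, h2⟩; refine ⟨?_, ?_, ?_⟩ <;> linarith

lemma convRegion_nonempty (a : ℕ) (s : ℂ) : (convRegion a s).Nonempty := by
  refine ⟨((max (2 + a) (3 + a - s.re) : ℝ) : ℂ), ?_, ?_⟩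
  · rw [Complex.ofReal_re]
    linarith [le_max_left (2 + a : ℝ) (3 + a - s.re)]
  · rw [Complex.add_re, Complex.ofReal_re]
    linarith [le_max_right (2 + a : ℝ) (3 + a - s.re)]

lemma convRegion_subset_remRegion (a K : ℕ) (s : ℂ) : convRegion a s ⊆ remRegion K s := by
  rintro t ⟨h1, h2⟩
  have ha : (0 : ℝ) ≤ a := a.cast_nonneg
  have hK : (0 : ℝ) ≤ K := K.cast_nonneg
  constructor <;> linarith

lemma differentiableOn_mtMain (a K : ℕ) (s : ℂ) {x : ℝ} (hx : 0 < x) :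
    DifferentiableOn ℂ (fun t => mtMain a K s t x) (convRegion a s) := by
  rintro t ⟨h1, h2⟩
  have ha : (0 : ℝ) ≤ a := a.cast_nonneg
  refine DifferentiableAt.differentiableWithinAt ?_
  have hζ : ∀ c : ℂ, (c.re ≤ a + 1) → DifferentiableAt ℂ (fun t => riemannZeta (s + t - c)) t := by
    intro c hc
    refine (differentiableAt_riemannZeta (s := s + t - c) fun h => ?_).comp t (by fun_prop)
    have := congrArg Complex.re h
    rw [Complex.sub_re, Complex.one_re] at this
    linarith
  have h3 : Differentiable ℂ fun t : ℂ => ∏ j ∈ Finset.range (a + 1), (t - ((j : ℂ) + 1)) := by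
    fun_prop
  have h4 := differentiable_ofReal_cpow hx (f := fun t => (a : ℂ) + 1 - t) (by fun_prop)
  have h5 := fun k : ℕ => differentiable_ofReal_cpow hx (f := fun t => -t - (k : ℂ)) (by fun_prop)
  have h6 : DifferentiableAt ℂ (fun t => riemannZeta (s + t - a - 1)) t := by
    simpa [sub_sub] using hζ (a + 1) (by simp)
  have h7 : ∀ k : ℕ, DifferentiableAt ℂ (fun t => riemannZeta (s + t + k)) t := fun k => by
    have hk : (0 : ℝ) ≤ k := k.cast_nonneg
    simpa using hζ (-k) (by simp; linarith)
  exact ((((differentiableAt_const _).div (h3 t) (prod_sub_ne_zero h1)).mul (h4 t)).mul h6).add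
    (DifferentiableAt.fun_sum fun k _ => ((((differentiable_fallNeg k t).div_const _).const_mul
      _).mul (h5 k t)).mul (h7 k))

/-- In the half-plane where the remainder is holomorphic, the continuation is the explicit part
plus the remainder. -/
lemma IsMordellTornheim.eventuallyEq {a K : ℕ} {s : ℂ} {x : ℝ} (hx : 0 < x) {Θ R : ℂ → ℂ}
    (hΘ : IsMordellTornheim (-(a : ℂ)) s x Θ) (hR : DifferentiableOn ℂ R (remRegion K s))
    (hs : ∀ t ∈ convRegion a s, HasSum (mtTerm (-(a : ℂ)) s t x) (mtMain a K s t x + R t))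
    {z : ℂ} (hz : z ∈ remRegion K s) :
    Θ =ᶠ[𝓝[≠] z] fun t => mtMain a K s t x + R t := by
  obtain ⟨w, hw⟩ := convRegion_nonempty a s
  refine MeromorphicOn.eventuallyEq_nhdsNE_of_isPreconnected (U := remRegion K s)
    (fun t _ => hΘ.1.meromorphicOn t (Set.mem_univ t))
    (fun t ht => (meromorphicAt_mtMain a K s hx t).add
      (hR.analyticAt ((isOpen_remRegion K s).mem_nhds ht)).meromorphicAt)
    (isPreconnected_remRegion K s) (convRegion_subset_remRegion a K s hw) hz ?_
  refine Filter.Eventually.filter_mono nhdsWithin_le_nhds ?_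
  filter_upwards [(isOpen_convRegion a s).mem_nhds hw] with t ht
  exact (hΘ.2 t (mem_mtRegion_iff.2 ht)).unique (hs t ht)

/-- The continuations to the half-planes `remRegion K s` are glued by the identity theorem. -/
theorem exists_isMordellTornheim (a : ℕ) (s : ℂ) {x : ℝ} (hx : 0 < x) :
    ∃ Θ : ℂ → ℂ, IsMordellTornheim (-(a : ℂ)) s x Θ := by
  choose R hR _ hs using fun K : ℕ => exists_remainder a hx s (K + 1) (by omega)
  let F : ℕ → ℂ → ℂ := fun K t => mtMain a (K + 1) s t x + R K t
  have hex : ∀ t : ℂ, ∃ K : ℕ, t ∈ remRegion (K + 1) s := fun t => by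
    obtain ⟨K, hK, ht⟩ := exists_mem_remRegion s t 1
    exact ⟨K - 1, by rwa [Nat.sub_add_cancel hK]⟩
  choose κ hκ using hex
  have hm : ∀ K, MeromorphicOn (F K) (remRegion (K + 1) s) := fun K t ht =>
    (meromorphicAt_mtMain a (K + 1) s hx t).add
      ((hR K).analyticAt ((isOpen_remRegion (K + 1) s).mem_nhds ht)).meromorphicAt
  have hmono : ∀ K L, K ≤ L → remRegion (K + 1) s ⊆ remRegion (L + 1) s := by
    rintro K L hKL t ⟨h1, h2⟩
    have : ((K + 1 : ℕ) : ℝ) ≤ (L + 1 : ℕ) := by exact_mod_cast Nat.succ_le_succ hKL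
    constructor <;> linarith
  obtain ⟨w, hw⟩ := convRegion_nonempty a s
  have hFeq : ∀ K L t, K ≤ L → t ∈ remRegion (K + 1) s → F K =ᶠ[𝓝[≠] t] F L := by
    intro K L t hKL ht
    refine MeromorphicOn.eventuallyEq_nhdsNE_of_isPreconnected (hm K)
      (fun z hz => hm L z (hmono K L hKL hz)) (isPreconnected_remRegion _ s)
      (convRegion_subset_remRegion a _ s hw) ht ?_
    refine Filter.Eventually.filter_mono nhdsWithin_le_nhds ?_
    filter_upwards [(isOpen_convRegion a s).mem_nhds hw] with z hz
    exact (hs K z hz.1 hz.2).unique (hs L z hz.1 hz.2)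
  have hFeq' : ∀ K L t, t ∈ remRegion (K + 1) s → t ∈ remRegion (L + 1) s →
      F K =ᶠ[𝓝[≠] t] F L := by
    intro K L t hK hL
    rcases le_total K L with h | h
    · exact hFeq K L t h hK
    · exact (hFeq L K t h hL).symm
  refine ⟨fun t => toMeromorphicNFAt (F (κ t)) t t, fun t _ => ?_, fun t ht => ?_⟩
  · have : (fun t => toMeromorphicNFAt (F (κ t)) t t) =ᶠ[𝓝 t]
        toMeromorphicNFOn (F (κ t)) (remRegion (κ t + 1) s) := by
      filter_upwards [(isOpen_remRegion (κ t + 1) s).mem_nhds (hκ t)] with z hz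
      rw [toMeromorphicNFOn_eq_toMeromorphicNFAt (hm _) hz]
      exact (toMeromorphicNFAt_eventuallyEq_nhds_congr (hFeq' _ _ z (hκ z) hz)).eq_of_nhds
    rw [meromorphicNFAt_congr this]
    exact meromorphicNFOn_toMeromorphicNFOn _ _ (hκ t)
  · have ht' := mem_mtRegion_iff.1 ht
    have hd : DifferentiableOn ℂ (F (κ t)) (convRegion a s) :=
      (differentiableOn_mtMain a _ s hx).add
        ((hR (κ t)).mono (convRegion_subset_remRegion a _ s))
    have han := hd.analyticAt ((isOpen_convRegion a s).mem_nhds ht')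
    have e : toMeromorphicNFAt (F (κ t)) t t = F (κ t) t := by
      rw [toMeromorphicNFAt_eq_self.2 han.meromorphicNFAt]
    simp only [e]
    exact hs (κ t) t ht'.1 ht'.2

theorem IsMordellTornheim.unique {a : ℕ} {s : ℂ} {x : ℝ} {Θ₁ Θ₂ : ℂ → ℂ}
    (h₁ : IsMordellTornheim (-(a : ℂ)) s x Θ₁) (h₂ : IsMordellTornheim (-(a : ℂ)) s x Θ₂) :
    Θ₁ = Θ₂ := by
  obtain ⟨w, hw⟩ := convRegion_nonempty a s
  funext t
  refine Filter.EventuallyEq.eq_of_nhds (x := t) ?_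
  rw [← (h₁.1 (Set.mem_univ t)).eventuallyEq_nhdsNE_iff_eventuallyEq_nhds
    (h₂.1 (Set.mem_univ t))]
  refine MeromorphicOn.eventuallyEq_nhdsNE_of_isPreconnected h₁.1.meromorphicOn h₂.1.meromorphicOn
    isPreconnected_univ (Set.mem_univ w) (Set.mem_univ t) ?_
  refine Filter.Eventually.filter_mono nhdsWithin_le_nhds ?_
  filter_upwards [(isOpen_convRegion a s).mem_nhds hw] with z hz
  exact (h₁.2 z (mem_mtRegion_iff.2 hz)).unique (h₂.2 z (mem_mtRegion_iff.2 hz))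

/-! ### Coefficients of the explicit part near a nonpositive integer -/

/-- The coefficient of `ζ (s + t - a - 1)` in `mtMain`. -/
noncomputable def leadCoeff (a : ℕ) (x : ℝ) (t : ℂ) : ℂ :=
  (a.factorial : ℂ) / (∏ j ∈ Finset.range (a + 1), (t - (j + 1))) * (x : ℂ) ^ (a + 1 - t)

/-- The coefficient of `ζ (s + t + k)` in `mtMain`. -/
noncomputable def termCoeff (a : ℕ) (x : ℝ) (k : ℕ) (t : ℂ) : ℂ :=
  riemannZeta (-a - k) * (fallNeg t k / k.factorial) * (x : ℂ) ^ (-t - k)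

lemma isBigO_mul_zeta_of_ne_one {A : ℂ → ℂ} {c t₀ : ℂ} (hA : DifferentiableAt ℂ A t₀)
    (hc : c + t₀ ≠ 1) :
    (fun t => A t * riemannZeta (c + t) - A t₀ * riemannZeta (c + t₀)) =O[𝓝[≠] t₀]
      fun t => t - t₀ := by
  have h : DifferentiableAt ℂ (fun t => A t * riemannZeta (c + t)) t₀ :=
    hA.mul ((differentiableAt_riemannZeta hc).comp t₀ (by fun_prop))
  exact h.isBigO_sub.mono nhdsWithin_le_nhds

/-- The first two terms of the Laurent expansion of `A t * ζ (c + t)` at the pole `t₀ = 1 - c` of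
the second factor. -/
lemma isBigO_mul_zeta_of_eq_one {A : ℂ → ℂ} {A' c t₀ : ℂ} (hA : AnalyticAt ℂ A t₀)
    (hA' : HasDerivAt A A' t₀) (hc : c + t₀ = 1) :
    (fun t => A t * riemannZeta (c + t) - (A t₀ / (t - t₀) + (A' + A t₀ * eulerC)))
      =O[𝓝[≠] t₀] fun t => t - t₀ := by
  have hd : DifferentiableAt ℂ (dslope A t₀) t₀ := by
    have h0 : ∀ᶠ t in 𝓝 t₀, DifferentiableAt ℂ A t :=
      hA.eventually_analyticAt.mono fun t ht => ht.differentiableAt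
    obtain ⟨U, hU, hUo, ht⟩ := eventually_nhds_iff.1 h0
    exact ((Complex.differentiableOn_dslope (hUo.mem_nhds ht)).2
      fun t ht => (hU t ht).differentiableWithinAt).differentiableAt (hUo.mem_nhds ht)
  have hH : DifferentiableAt ℂ (fun t => dslope A t₀ t + A t * riemannZeta₀ (c + t)) t₀ :=
    hd.add (hA.differentiableAt.mul
      ((differentiable_riemannZeta₀ (c + t₀)).comp t₀ (by fun_prop)))
  refine (hH.isBigO_sub.mono nhdsWithin_le_nhds).congr' ?_ EventuallyEq.rfl
  filter_upwards [self_mem_nhdsWithin] with t ht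
  have ht' : t - t₀ ≠ 0 := sub_ne_zero.2 ht
  have hct : c + t ≠ 1 := fun h => ht' (by linear_combination h - hc)
  rw [dslope_same, hA'.deriv, dslope_of_ne _ ht, slope_def_field, hc, riemannZeta₀_one,
    riemannZeta_eq_inv_sub_add hct, show c + t - 1 = t - t₀ by linear_combination hc, eulerC]
  field_simp
  ring

lemma differentiable_termCoeff (a k : ℕ) {x : ℝ} (hx : 0 < x) :
    Differentiable ℂ (termCoeff a x k) :=
  (((differentiable_fallNeg k).div_const _).const_mul _).mul
    (differentiable_ofReal_cpow hx (by fun_prop))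

lemma prod_neg_sub (N n : ℕ) :
    (N.factorial : ℂ) * ∏ j ∈ Finset.range n, (-(N : ℂ) - (j + 1)) =
      (-1) ^ n * ((N + n).factorial : ℂ) := by
  induction n with
  | zero => simp
  | succ n ih =>
    rw [Finset.prod_range_succ, ← mul_assoc, ih, ← add_assoc, Nat.factorial_succ]
    push_cast
    ring

lemma prod_neg_sub_ne_zero (N n : ℕ) : ∏ j ∈ Finset.range n, (-(N : ℂ) - (j + 1)) ≠ 0 := by
  intro h
  have := prod_neg_sub N n
  rw [h, mul_zero] at this
  have h1 : ((N + n).factorial : ℂ) ≠ 0 := by exact_mod_cast (N + n).factorial_ne_zero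
  exact mul_ne_zero (pow_ne_zero _ (by norm_num)) h1 this.symm

lemma harmonic_succ_cast (n : ℕ) :
    ((harmonic (n + 1) : ℚ) : ℂ) = ((harmonic n : ℚ) : ℂ) + 1 / (n + 1) := by
  rw [harmonic_succ]; push_cast; rw [one_div]

lemma hasDerivAt_prod_sub (N n : ℕ) :
    HasDerivAt (fun t : ℂ => ∏ j ∈ Finset.range n, (t - (j + 1)))
      (-(∏ j ∈ Finset.range n, (-(N : ℂ) - (j + 1))) *
        (((harmonic (N + n) : ℚ) : ℂ) - ((harmonic N : ℚ) : ℂ))) (-(N : ℂ)) := by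
  induction n with
  | zero => simpa using hasDerivAt_const (-(N : ℂ)) (1 : ℂ)
  | succ n ih =>
    simp only [Finset.prod_range_succ]
    have h := ih.mul ((hasDerivAt_id (-(N : ℂ))).sub_const ((n : ℂ) + 1))
    refine h.congr_deriv ?_
    have h0 : (N : ℂ) + n + 1 ≠ 0 := by exact_mod_cast Nat.succ_ne_zero (N + n)
    rw [← add_assoc, harmonic_succ_cast]
    push_cast
    simp only [id]
    field_simp
    ring

lemma hasDerivAt_ofReal_cpow_neg {x : ℝ} (hx : 0 < x) (b t : ℂ) :
    HasDerivAt (fun t : ℂ => (x : ℂ) ^ (b - t)) (-(x : ℂ) ^ (b - t) * logC x) t := by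
  have h := ((hasDerivAt_id t).const_sub b).const_cpow (c := (x : ℂ))
    (Or.inl (by exact_mod_cast hx.ne'))
  refine h.congr_deriv ?_
  rw [logC, Complex.ofReal_log hx.le]
  simp

lemma analyticAt_leadCoeff (a N : ℕ) {x : ℝ} (hx : 0 < x) :
    AnalyticAt ℂ (leadCoeff a x) (-(N : ℂ)) := by
  have h1 : Differentiable ℂ fun t : ℂ => ∏ j ∈ Finset.range (a + 1), (t - ((j : ℂ) + 1)) := by
    fun_prop
  have h2 := differentiable_ofReal_cpow hx (f := fun t => (a : ℂ) + 1 - t) (by fun_prop)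
  exact (analyticAt_const.div (h1.analyticAt _) (prod_neg_sub_ne_zero N (a + 1))).mul
    (h2.analyticAt _)

lemma hasDerivAt_leadCoeff (a N : ℕ) {x : ℝ} (hx : 0 < x) :
    HasDerivAt (leadCoeff a x) (leadCoeff a x (-(N : ℂ)) *
      (((harmonic (N + (a + 1)) : ℚ) : ℂ) - ((harmonic N : ℚ) : ℂ) - logC x)) (-(N : ℂ)) := by
  have hP := prod_neg_sub_ne_zero N (a + 1)
  have h := (((hasDerivAt_prod_sub N (a + 1)).inv hP).const_mul (a.factorial : ℂ)).mul
    (hasDerivAt_ofReal_cpow_neg hx (a + 1) (-(N : ℂ)))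
  refine (h.congr_deriv ?_).congr_of_eventuallyEq
    (Eventually.of_forall fun t => by simp [leadCoeff, div_eq_mul_inv])
  rw [leadCoeff]
  simp only [Pi.inv_apply]
  field_simp
  ring

lemma leadCoeff_neg_natCast (a N : ℕ) {x : ℝ} :
    leadCoeff a x (-(N : ℂ)) = (-1) ^ (a + 1) * (a.factorial : ℂ) *
      ((N.factorial : ℂ) / ((N + (a + 1)).factorial : ℂ)) * (x : ℂ) ^ (N + (a + 1)) := by
  have h := prod_neg_sub N (a + 1)
  have hP := prod_neg_sub_ne_zero N (a + 1)
  have h1 : ((N + (a + 1)).factorial : ℂ) ≠ 0 := by exact_mod_cast Nat.factorial_ne_zero _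
  have h2 : ((-1 : ℂ) ^ (a + 1)) * (-1) ^ (a + 1) = 1 := by
    rw [← mul_pow]; simp
  rw [leadCoeff, show (a : ℂ) + 1 - -(N : ℂ) = ((N + (a + 1) : ℕ) : ℂ) by push_cast; ring,
    Complex.cpow_natCast]
  congr 1
  rw [mul_div_assoc', div_eq_div_iff hP h1]
  generalize ∏ j ∈ Finset.range (a + 1), (-(N : ℂ) - (j + 1)) = P at *
  linear_combination (-(a.factorial : ℂ) * (-1) ^ (a + 1)) * h -
    (a.factorial : ℂ) * ((N + (a + 1)).factorial : ℂ) * h2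

lemma fallNeg_neg_natCast_of_le {N k : ℕ} (h : k ≤ N) :
    fallNeg (-(N : ℂ)) k = (N.factorial : ℂ) / ((N - k).factorial : ℂ) := by
  induction k with
  | zero =>
    have : (N.factorial : ℂ) ≠ 0 := by exact_mod_cast N.factorial_ne_zero
    simp [fallNeg, this]
  | succ k ih =>
    obtain ⟨d, rfl⟩ := Nat.exists_eq_add_of_le h
    have h1 : k + 1 + d - k = d + 1 := by omega
    have h2 : k + 1 + d - (k + 1) = d := by omega
    rw [fallNeg_succ, ih (by omega), h1, h2, Nat.factorial_succ]
    have h3 : ((d : ℂ) + 1) ≠ 0 := by exact_mod_cast Nat.succ_ne_zero d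
    have h4 : (d.factorial : ℂ) ≠ 0 := by exact_mod_cast d.factorial_ne_zero
    push_cast
    field_simp
    ring

lemma hasDerivAt_fallNeg_of_le {N k : ℕ} (h : k ≤ N) :
    HasDerivAt (fun t => fallNeg t k) (fallNeg (-(N : ℂ)) k *
      (((harmonic (N - k) : ℚ) : ℂ) - ((harmonic N : ℚ) : ℂ))) (-(N : ℂ)) := by
  induction k with
  | zero => simpa [fallNeg] using hasDerivAt_const (-(N : ℂ)) (1 : ℂ)
  | succ k ih =>
    obtain ⟨d, rfl⟩ := Nat.exists_eq_add_of_le h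
    have h1 : k + 1 + d - k = d + 1 := by omega
    have h2 : k + 1 + d - (k + 1) = d := by omega
    have h3 : ((d : ℂ) + 1) ≠ 0 := by exact_mod_cast Nat.succ_ne_zero d
    simp only [fallNeg_succ]
    refine ((ih (by omega)).mul ((hasDerivAt_id _).neg.sub_const (k : ℂ))).congr_deriv ?_
    rw [h1, h2, harmonic_succ_cast]
    push_cast
    simp only [Pi.neg_apply]
    field_simp
    ring

/-- Beyond `k = N` the falling factorial has a simple zero at `-N`. -/
lemma hasDerivAt_fallNeg_of_lt (N q : ℕ) :
    HasDerivAt (fun t => fallNeg t (N + 1 + q))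
      ((-1) ^ (q + 1) * (N.factorial : ℂ) * (q.factorial : ℂ)) (-(N : ℂ)) := by
  induction q with
  | zero =>
    simp only [add_zero, fallNeg_succ]
    refine ((hasDerivAt_fallNeg_of_le le_rfl).mul
      ((hasDerivAt_id _).neg.sub_const (N : ℂ))).congr_deriv ?_
    rw [fallNeg_neg_natCast_of_le le_rfl]
    simp
  | succ q ih =>
    simp only [← add_assoc, fallNeg_succ]
    refine (ih.mul ((hasDerivAt_id _).neg.sub_const ((N + 1 + q : ℕ) : ℂ))).congr_deriv ?_
    rw [fallNeg_neg_natCast (show N < N + 1 + q by omega), Nat.factorial_succ]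
    push_cast
    simp only [Pi.neg_apply]
    ring

lemma termCoeff_neg_natCast_of_lt {a N k : ℕ} {x : ℝ} (h : N < k) :
    termCoeff a x k (-(N : ℂ)) = 0 := by
  simp [termCoeff, fallNeg_neg_natCast h]

lemma termCoeff_neg_natCast_of_le {a N k : ℕ} {x : ℝ} (h : k ≤ N) :
    termCoeff a x k (-(N : ℂ)) = riemannZeta (-a - k) *
      ((N.factorial : ℂ) / ((k.factorial : ℂ) * ((N - k).factorial : ℂ))) * (x : ℂ) ^ (N - k) := by
  rw [termCoeff, fallNeg_neg_natCast_of_le h,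
    show - -(N : ℂ) - k = ((N - k : ℕ) : ℂ) by rw [Nat.cast_sub h]; ring, Complex.cpow_natCast,
    div_div, mul_comm (k.factorial : ℂ)]

lemma hasDerivAt_termCoeff_of_le {a N k : ℕ} {x : ℝ} (hx : 0 < x) (h : k ≤ N) :
    HasDerivAt (termCoeff a x k) (termCoeff a x k (-(N : ℂ)) *
      (((harmonic (N - k) : ℚ) : ℂ) - ((harmonic N : ℚ) : ℂ) - logC x)) (-(N : ℂ)) := by
  have h1 := hasDerivAt_ofReal_cpow_neg hx (-(k : ℂ)) (-(N : ℂ))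
  simp only [show ∀ t : ℂ, -(k : ℂ) - t = -t - k from fun t => by ring] at h1
  refine ((((hasDerivAt_fallNeg_of_le h).div_const (k.factorial : ℂ)).const_mul
    (riemannZeta (-a - k))).mul h1).congr_deriv ?_
  rw [termCoeff]
  ring

lemma hasDerivAt_termCoeff_of_lt (a N q : ℕ) {x : ℝ} (hx : 0 < x) :
    HasDerivAt (termCoeff a x (N + 1 + q)) ((-1) ^ (q + 1) * (x : ℂ) ^ (-(q : ℤ) - 1) *
      ((N.factorial : ℂ) * (q.factorial : ℂ) / ((N + 1 + q).factorial : ℂ)) *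
      riemannZeta (-a - (N + 1 + q : ℕ))) (-(N : ℂ)) := by
  have h1 := hasDerivAt_ofReal_cpow_neg hx (-((N + 1 + q : ℕ) : ℂ)) (-(N : ℂ))
  simp only [show ∀ t : ℂ, -((N + 1 + q : ℕ) : ℂ) - t = -t - (N + 1 + q : ℕ) from
    fun t => by ring] at h1
  refine ((((hasDerivAt_fallNeg_of_lt N q).div_const ((N + 1 + q).factorial : ℂ)).const_mul
    (riemannZeta (-a - (N + 1 + q : ℕ)))).mul h1).congr_deriv ?_
  rw [fallNeg_neg_natCast (show N < N + 1 + q by omega),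
    show - -(N : ℂ) - (N + 1 + q : ℕ) = ((-(q : ℤ) - 1 : ℤ) : ℂ) by push_cast; ring,
    Complex.cpow_intCast]
  ring

/-! ### Expansions at a nonpositive integer -/

/-- An expansion of `Θ` at `-N` is obtained by expanding every term of `mtMain`: the remainder
contributes nothing, as it is holomorphic and vanishes at `-N`. -/
theorem IsMordellTornheim.isBigO_sub {a : ℕ} {s : ℂ} {x : ℝ} (hx : 0 < x) {Θ : ℂ → ℂ}
    (hΘ : IsMordellTornheim (-(a : ℂ)) s x Θ) (N K₀ : ℕ) (L : ℂ → ℂ) (c : ℕ → ℂ → ℂ)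
    (hL : (fun t => leadCoeff a x t * riemannZeta (s - a - 1 + t) - L t) =O[𝓝[≠] (-(N : ℂ))]
      fun t => t - -(N : ℂ))
    (hc : ∀ k, (fun t => termCoeff a x k t * riemannZeta (s + k + t) - c k t)
      =O[𝓝[≠] (-(N : ℂ))] fun t => t - -(N : ℂ))
    (hc0 : ∀ k, K₀ ≤ k → ∀ t, c k t = 0) :
    (fun t => Θ t - (L t + ∑ k ∈ Finset.range K₀, c k t)) =O[𝓝[≠] (-(N : ℂ))]
      fun t => t - -(N : ℂ) := by
  obtain ⟨K, hK, hN⟩ := exists_mem_remRegion s (-(N : ℂ)) (max K₀ (N + 1))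
  obtain ⟨R, hR, hz, hs⟩ := exists_remainder a hx s K (by omega)
  have hRO : R =O[𝓝[≠] (-(N : ℂ))] fun t => t - -(N : ℂ) := by
    have h := (hR.differentiableAt ((isOpen_remRegion K s).mem_nhds hN)).isBigO_sub
    rw [hz N (by omega)] at h
    simpa using h.mono (nhdsWithin_le_nhds (s := {-(N : ℂ)}ᶜ))
  have hsum := Asymptotics.IsBigO.sum (s := Finset.range K) fun k _ => hc k
  refine ((hL.add hsum).add hRO).congr' ?_ EventuallyEq.rfl
  filter_upwards [hΘ.eventuallyEq hx hR (fun t ht => hs t ht.1 ht.2) hN] with t ht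
  have h1 : ∑ k ∈ Finset.range K₀, c k t = ∑ k ∈ Finset.range K, c k t :=
    Finset.sum_subset (Finset.range_subset_range.2 (by omega))
      fun k _ hk => hc0 k (by simpa using hk) t
  have h2 : mtMain a K s t x = leadCoeff a x t * riemannZeta (s - a - 1 + t) +
      ∑ k ∈ Finset.range K, termCoeff a x k t * riemannZeta (s + k + t) := by
    rw [mtMain, show s + t - a - 1 = s - a - 1 + t by ring]
    simp only [leadCoeff, termCoeff, add_right_comm s t]
  rw [ht, h1, h2, Finset.sum_apply, Finset.sum_sub_distrib]
  ring

/-- If a function in normal form has a limit up to `O(t - t₀)` on a punctured neighbourhood, then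
it is holomorphic at `t₀`, with that limit as its value. -/
lemma MeromorphicNFAt.isBigO_nhds {Θ : ℂ → ℂ} {t₀ C : ℂ} (h : MeromorphicNFAt Θ t₀)
    (hO : (fun t => Θ t - C) =O[𝓝[≠] t₀] fun t => t - t₀) :
    (fun t => Θ t - C) =O[𝓝 t₀] fun t => t - t₀ := by
  have h1 : Tendsto (fun t => t - t₀) (𝓝[≠] t₀) (𝓝 0) := by
    have : Tendsto (fun t => t - t₀) (𝓝 t₀) (𝓝 (t₀ - t₀)) := tendsto_id.sub_const t₀
    rw [sub_self] at this
    exact this.mono_left nhdsWithin_le_nhds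
  have h2 : Tendsto Θ (𝓝[≠] t₀) (𝓝 C) := tendsto_sub_nhds_zero_iff.1 (hO.trans_tendsto h1)
  have h3 : AnalyticAt ℂ Θ t₀ := h.meromorphicOrderAt_nonneg_iff_analyticAt.1
    ((tendsto_nhds_iff_meromorphicOrderAt_nonneg h.meromorphicAt).1 ⟨C, h2⟩)
  rw [tendsto_nhds_unique h2 (h3.continuousAt.tendsto.mono_left nhdsWithin_le_nhds)]
  exact h3.differentiableAt.isBigO_sub

section Cases

variable {a : ℕ} {s : ℂ} {x : ℝ} {Θ : ℂ → ℂ} {N : ℕ}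

lemma isBigO_termCoeff_of_ne (hx : 0 < x) {k : ℕ} (h : s + k + -(N : ℂ) ≠ 1) :
    (fun t => termCoeff a x k t * riemannZeta (s + k + t) -
      termCoeff a x k (-(N : ℂ)) * riemannZeta (s + k + -(N : ℂ))) =O[𝓝[≠] (-(N : ℂ))]
      fun t => t - -(N : ℂ) :=
  isBigO_mul_zeta_of_ne_one (differentiable_termCoeff a k hx _) h

lemma isBigO_leadCoeff_of_ne (hx : 0 < x) (h : s - a - 1 + -(N : ℂ) ≠ 1) :
    (fun t => leadCoeff a x t * riemannZeta (s - a - 1 + t) -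
      leadCoeff a x (-(N : ℂ)) * riemannZeta (s - a - 1 + -(N : ℂ))) =O[𝓝[≠] (-(N : ℂ))]
      fun t => t - -(N : ℂ) :=
  isBigO_mul_zeta_of_ne_one (analyticAt_leadCoeff a N hx).differentiableAt h

/-- No zeta factor has its pole at `-N`. -/
theorem IsMordellTornheim.isBigO_of_regular (hx : 0 < x)
    (hΘ : IsMordellTornheim (-(a : ℂ)) s x Θ) (h1 : s - a - 1 + -(N : ℂ) ≠ 1)
    (h2 : ∀ k : ℕ, s + k + -(N : ℂ) ≠ 1) :
    (fun t => Θ t - (leadCoeff a x (-(N : ℂ)) * riemannZeta (s - a - 1 + -(N : ℂ)) +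
      ∑ k ∈ Finset.range (N + 1), termCoeff a x k (-(N : ℂ)) * riemannZeta (s + k + -(N : ℂ))))
      =O[𝓝 (-(N : ℂ))] fun t => t - -(N : ℂ) := by
  refine (hΘ.1 (Set.mem_univ _)).isBigO_nhds ?_
  refine hΘ.isBigO_sub hx N (N + 1) (fun _ => _) (fun k _ => _) (isBigO_leadCoeff_of_ne hx h1)
    (fun k => isBigO_termCoeff_of_ne hx (h2 k)) fun k hk t => ?_
  simp only [termCoeff_neg_natCast_of_lt (show N < k by omega), zero_mul]

/-- The zeta factor of the leading term has its pole at `-N`. -/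
theorem IsMordellTornheim.isBigO_of_pole_lead (hx : 0 < x)
    (hΘ : IsMordellTornheim (-(a : ℂ)) s x Θ) (hs : s = N + a + 2) :
    (fun t => Θ t - (leadCoeff a x (-(N : ℂ)) / (t - -(N : ℂ)) +
      (leadCoeff a x (-(N : ℂ)) *
        (((harmonic (N + (a + 1)) : ℚ) : ℂ) - ((harmonic N : ℚ) : ℂ) - logC x) +
        leadCoeff a x (-(N : ℂ)) * eulerC) +
      ∑ k ∈ Finset.range (N + 1), termCoeff a x k (-(N : ℂ)) * riemannZeta (s + k + -(N : ℂ))))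
      =O[𝓝[≠] (-(N : ℂ))] fun t => t - -(N : ℂ) := by
  refine hΘ.isBigO_sub hx N (N + 1) (fun t => _) (fun k _ => _)
    (isBigO_mul_zeta_of_eq_one (analyticAt_leadCoeff a N hx) (hasDerivAt_leadCoeff a N hx)
      (by rw [hs]; ring))
    (fun k => isBigO_termCoeff_of_ne hx fun h => ?_) fun k hk t => ?_
  · have h' : ((a + 1 + k : ℕ) : ℂ) = 0 := by push_cast; linear_combination h - hs
    exact absurd (Nat.cast_eq_zero.1 h') (by omega)
  · simp only [termCoeff_neg_natCast_of_lt (show N < k by omega), zero_mul]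

/-- The zeta factor with index `k = N + 1 + q` has its pole at `-N`, where it is cancelled by the
zero of the binomial coefficient. -/
theorem IsMordellTornheim.isBigO_of_cancelled_pole (hx : 0 < x)
    (hΘ : IsMordellTornheim (-(a : ℂ)) s x Θ) {q : ℕ} (hs : s = -(q : ℂ)) :
    (fun t => Θ t - (leadCoeff a x (-(N : ℂ)) * riemannZeta (s - a - 1 + -(N : ℂ)) +
      (∑ k ∈ Finset.range (N + 1), termCoeff a x k (-(N : ℂ)) * riemannZeta (s + k + -(N : ℂ)) +
      (-1) ^ (q + 1) * (x : ℂ) ^ (-(q : ℤ) - 1) *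
      ((N.factorial : ℂ) * (q.factorial : ℂ) / ((N + 1 + q).factorial : ℂ)) *
      riemannZeta (-a - (N + 1 + q : ℕ)))))
      =O[𝓝 (-(N : ℂ))] fun t => t - -(N : ℂ) := by
  refine (hΘ.1 (Set.mem_univ _)).isBigO_nhds ?_
  set D : ℂ := (-1) ^ (q + 1) * (x : ℂ) ^ (-(q : ℤ) - 1) *
      ((N.factorial : ℂ) * (q.factorial : ℂ) / ((N + 1 + q).factorial : ℂ)) *
      riemannZeta (-a - (N + 1 + q : ℕ))
  have hlt : ∀ k : ℕ, N < k → termCoeff a x k (-(N : ℂ)) = 0 := fun k hk =>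
    termCoeff_neg_natCast_of_lt hk
  have h := hΘ.isBigO_sub hx N (N + 1 + q + 1)
    (fun _ => leadCoeff a x (-(N : ℂ)) * riemannZeta (s - a - 1 + -(N : ℂ)))
    (fun k _ => if k = N + 1 + q then D else
      termCoeff a x k (-(N : ℂ)) * riemannZeta (s + k + -(N : ℂ)))
    (isBigO_leadCoeff_of_ne hx fun h => ?_) (fun k => ?_) fun k hk t => ?_
  · refine h.congr_left fun t => ?_
    rw [Finset.sum_range_succ, if_pos rfl]
    have hsub : Finset.range (N + 1) ⊆ Finset.range (N + 1 + q) :=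
      Finset.range_subset_range.2 (by omega)
    have hsum : ∑ k ∈ Finset.range (N + 1 + q), (if k = N + 1 + q then D else
        termCoeff a x k (-(N : ℂ)) * riemannZeta (s + k + -(N : ℂ))) =
        ∑ k ∈ Finset.range (N + 1), termCoeff a x k (-(N : ℂ)) *
          riemannZeta (s + k + -(N : ℂ)) := by
      rw [← Finset.sum_subset hsub]
      · refine Finset.sum_congr rfl fun k hk => if_neg ?_
        have := Finset.mem_range.1 hk
        omega
      · intro k h1 h2
        have h1 := Finset.mem_range.1 h1
        have h2 := mt Finset.mem_range.2 h2
        rw [if_neg (by omega), hlt k (by omega), zero_mul]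
    rw [hsum]
  · have h' : ((q + a + 2 + N : ℕ) : ℂ) = 0 := by push_cast; linear_combination -h + hs
    exact absurd (Nat.cast_eq_zero.1 h') (by omega)
  · by_cases hk : k = N + 1 + q
    · subst hk
      simp only [if_true]
      have h := isBigO_mul_zeta_of_eq_one (c := s + (N + 1 + q : ℕ))
        ((differentiable_termCoeff a (N + 1 + q) hx).analyticAt (-(N : ℂ)))
        (hasDerivAt_termCoeff_of_lt a N q hx) (by rw [hs]; push_cast; ring)
      rw [hlt (N + 1 + q) (by omega)] at h
      simp only [zero_div, zero_mul, zero_add, add_zero] at h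
      exact h
    · simp only [if_neg hk]
      refine isBigO_termCoeff_of_ne hx fun h => hk ?_
      have h' : (k : ℂ) = ((N + 1 + q : ℕ) : ℂ) := by push_cast; linear_combination h - hs
      exact Nat.cast_injective h'
  · simp only [if_neg (show k ≠ N + 1 + q by omega), hlt k (by omega), zero_mul]

/-- The zeta factor with index `k₀ ≤ N` has its pole at `-N`. -/
theorem IsMordellTornheim.isBigO_of_pole (hx : 0 < x)
    (hΘ : IsMordellTornheim (-(a : ℂ)) s x Θ) {k₀ : ℕ} (hk₀ : k₀ ≤ N) (hs : s = N + 1 - k₀) :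
    (fun t => Θ t - (leadCoeff a x (-(N : ℂ)) * riemannZeta (s - a - 1 + -(N : ℂ)) +
      (∑ k ∈ (Finset.range (N + 1)).filter (fun k => k ≠ k₀),
        termCoeff a x k (-(N : ℂ)) * riemannZeta (s + k + -(N : ℂ)) +
      (termCoeff a x k₀ (-(N : ℂ)) / (t - -(N : ℂ)) + (termCoeff a x k₀ (-(N : ℂ)) *
        (((harmonic (N - k₀) : ℚ) : ℂ) - ((harmonic N : ℚ) : ℂ) - logC x) +
        termCoeff a x k₀ (-(N : ℂ)) * eulerC)))))
      =O[𝓝[≠] (-(N : ℂ))] fun t => t - -(N : ℂ) := by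
  have h := hΘ.isBigO_sub hx N (N + 1)
    (fun _ => leadCoeff a x (-(N : ℂ)) * riemannZeta (s - a - 1 + -(N : ℂ)))
    (fun k t => if k ≠ k₀ then
      termCoeff a x k (-(N : ℂ)) * riemannZeta (s + k + -(N : ℂ)) else
      termCoeff a x k₀ (-(N : ℂ)) / (t - -(N : ℂ)) + (termCoeff a x k₀ (-(N : ℂ)) *
        (((harmonic (N - k₀) : ℚ) : ℂ) - ((harmonic N : ℚ) : ℂ) - logC x) +
        termCoeff a x k₀ (-(N : ℂ)) * eulerC))
    (isBigO_leadCoeff_of_ne hx fun h => ?_) (fun k => ?_) fun k hk t => ?_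
  · refine h.congr_left fun t => ?_
    rw [Finset.sum_ite]
    congr 3
    rw [show (Finset.range (N + 1)).filter (fun k => ¬k ≠ k₀) = {k₀} by
      ext k; simp only [Finset.mem_filter, Finset.mem_range, Finset.mem_singleton]; omega,
      Finset.sum_singleton]
  · have h' : ((k₀ + a + 1 : ℕ) : ℂ) = 0 := by push_cast; linear_combination -h + hs
    exact absurd (Nat.cast_eq_zero.1 h') (by omega)
  · by_cases hk : k = k₀
    · subst hk
      simp only [ne_eq, not_true_eq_false, if_false]
      exact isBigO_mul_zeta_of_eq_one ((differentiable_termCoeff a k hx).analyticAt _)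
        (hasDerivAt_termCoeff_of_le hx hk₀) (by rw [hs]; ring)
    · simp only [ne_eq, hk, not_false_eq_true, if_true]
      refine isBigO_termCoeff_of_ne hx fun h => hk ?_
      have h' : (k : ℂ) = (k₀ : ℂ) := by linear_combination h - hs
      exact Nat.cast_injective h'
  · simp only [if_pos (show k ≠ k₀ by omega), termCoeff_neg_natCast_of_lt (show N < k by omega),
      zero_mul]

end Cases

/-! ### The four cases -/

theorem theorem2p3 (r : ℤ) (hr : r ≤ 0) (ℓ : ℕ) (hℓ : 1 - r ≤ (ℓ : ℤ)) (x : ℝ) (hx : 0 < x) :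
    -- the meromorphic continuation in the third variable exists and is unique
    (∀ s : ℂ, ∃! Θ : ℂ → ℂ, IsMordellTornheim (r : ℂ) s x Θ) ∧
    -- Case I
    (∀ s : ℂ, ((∃ n : ℤ, s = (n : ℂ) ∧ r + ℓ < n ∧ n ≠ ℓ + 1) ∨ (∀ n : ℤ, s ≠ (n : ℂ))) →
      ∀ Θ : ℂ → ℂ, IsMordellTornheim (r : ℂ) s x Θ →
        (fun t : ℂ => Θ t -
          ((-1 : ℂ) ^ (r - 1) * (factZ (r + ℓ - 1) / factZ ℓ) * (x : ℂ) ^ ℓ *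
              Complex.Gamma (1 - (r : ℂ)) * riemannZeta (s - ℓ)
            + ∑ k ∈ Finset.range (r + ℓ).toNat,
                factZ (r + ℓ - 1) * riemannZeta ((r : ℂ) - k) /
                  ((x : ℂ) ^ (1 - r - ℓ + k : ℤ) * factZ k * factZ (r + ℓ - k - 1)) *
                  riemannZeta (-(r : ℂ) + s - ℓ + k + 1)))
          =O[𝓝 (mtCentre r ℓ)] (fun t : ℂ => t - mtCentre r ℓ)) ∧
    -- Case II
    (∀ s : ℤ, r + ℓ < s → s = ℓ + 1 →
      ∀ Θ : ℂ → ℂ, IsMordellTornheim (r : ℂ) (s : ℂ) x Θ →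
        (fun t : ℂ => Θ t -
          ((-1 : ℂ) ^ (r - 1) * factZ (-r) * (x : ℂ) ^ ℓ *
              (factZ (r + ℓ - 1) / (factZ ℓ * (t - mtCentre r ℓ)))
            + (-1 : ℂ) ^ (r - 1) * factZ (-r) * (x : ℂ) ^ ℓ * (factZ (r + ℓ - 1) / factZ ℓ) *
                (eulerC - logC x + harmZ ℓ - harmZ (r + ℓ - 1))
            + ∑ k ∈ Finset.range (r + ℓ).toNat,
                ((r + ℓ - 1).toNat.choose k : ℂ) *
                  (riemannZeta ((r : ℂ) - k) / (x : ℂ) ^ (k - r - ℓ + 1 : ℤ)) *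
                  riemannZeta (k - (r : ℂ) + 2)))
          =O[𝓝[≠] (mtCentre r ℓ)] (fun t : ℂ => t - mtCentre r ℓ)) ∧
    -- Case III
    (∀ s : ℤ, s ≤ 0 → s ≤ r + ℓ →
      ∀ Θ : ℂ → ℂ, IsMordellTornheim (r : ℂ) (s : ℂ) x Θ →
        (fun t : ℂ => Θ t -
          ((-1 : ℂ) ^ (r - 1) * (x : ℂ) ^ ℓ * (factZ (-r) * factZ (r + ℓ - 1) / factZ ℓ) *
              riemannZeta ((s : ℂ) - ℓ)
            + ∑ k ∈ Finset.range (r + ℓ).toNat,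
                riemannZeta ((r : ℂ) - k) * factZ (r + ℓ - 1) /
                  ((x : ℂ) ^ (k - r - ℓ + 1 : ℤ) * factZ k * factZ (r + ℓ - k - 1)) *
                  riemannZeta ((s : ℂ) + 1 - r - ℓ + k)
            + (-1 : ℂ) ^ (s - 1) * (x : ℂ) ^ (s - 1) *
                (factZ (r + ℓ - 1) * factZ (-s) / factZ (r + ℓ - s)) *
                riemannZeta ((s : ℂ) - ℓ)))
          =O[𝓝 (mtCentre r ℓ)] (fun t : ℂ => t - mtCentre r ℓ)) ∧
    -- Case IV
    (∀ s : ℤ, 1 ≤ s → s ≤ r + ℓ →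
      ∀ Θ : ℂ → ℂ, IsMordellTornheim (r : ℂ) (s : ℂ) x Θ →
        (fun t : ℂ => Θ t -
          ((x : ℂ) ^ (s - 1) * (factZ (r + ℓ - 1) / (factZ (r + ℓ - s) * factZ (s - 1))) *
              (riemannZeta ((s : ℂ) - ℓ) / (t - mtCentre r ℓ))
            + (x : ℂ) ^ (s - 1) * (factZ (r + ℓ - 1) / (factZ (r + ℓ - s) * factZ (s - 1))) *
                (eulerC - harmZ (r + ℓ - 1) + harmZ (s - 1) - logC x) *
                riemannZeta ((s : ℂ) - ℓ)
            - (-1 : ℂ) ^ r * (x : ℂ) ^ ℓ * (factZ (-r) * factZ (r + ℓ - 1) / factZ ℓ) *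
                riemannZeta ((s : ℂ) - ℓ)
            + ∑ k ∈ (Finset.range (r + ℓ).toNat).filter (fun k : ℕ => (k : ℤ) ≠ r + ℓ - s),
                factZ (r + ℓ - 1) * riemannZeta ((r : ℂ) - k) /
                  (factZ (r + ℓ - k - 1) * (x : ℂ) ^ (k - r - ℓ + 1 : ℤ) * factZ k) *
                  riemannZeta ((s : ℂ) - r - ℓ + k + 1)))
          =O[𝓝[≠] (mtCentre r ℓ)] (fun t : ℂ => t - mtCentre r ℓ)) := by
  obtain ⟨a, rfl⟩ : ∃ a : ℕ, r = -(a : ℤ) := ⟨r.natAbs, by omega⟩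
  obtain ⟨N, rfl⟩ : ∃ N : ℕ, ℓ = N + (a + 1) := ⟨ℓ - (a + 1), by omega⟩
  have ea : (((-(a : ℤ) : ℤ)) : ℂ) = -(a : ℂ) := by push_cast; rfl
  have hcen : mtCentre (-(a : ℤ)) (N + (a + 1)) = -(N : ℂ) := by
    simp only [mtCentre]; push_cast; ring
  have e1 : -(a : ℤ) + ((N + (a + 1) : ℕ) : ℤ) = ((N + 1 : ℕ) : ℤ) := by push_cast; ring
  have e2 : ((N + 1 : ℕ) : ℤ) - 1 = (N : ℤ) := by push_cast; ring
  have e3 : ∀ n : ℕ, factZ (n : ℤ) = (n.factorial : ℂ) := fun n => by simp [factZ]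
  have e4 : ∀ n : ℕ, harmZ (n : ℤ) = ((harmonic n : ℚ) : ℂ) := fun n => by simp [harmZ]
  have e5 : (-1 : ℂ) ^ (-(a : ℤ) - 1) = (-1) ^ (a + 1) := by
    rw [show -(a : ℤ) - 1 = -((a + 1 : ℕ) : ℤ) by push_cast; ring, zpow_neg, zpow_natCast,
      ← inv_pow]
    norm_num
  have hx0 : (x : ℂ) ≠ 0 := by exact_mod_cast hx.ne'
  have e6 : ∀ k ∈ Finset.range (N + 1), factZ (((N + 1 : ℕ) : ℤ) - k - 1) =
      ((N - k).factorial : ℂ) := fun k hk => by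
    have := Finset.mem_range.1 hk
    rw [show ((N + 1 : ℕ) : ℤ) - k - 1 = ((N - k : ℕ) : ℤ) by omega, e3]
  have e7 : ∀ k ∈ Finset.range (N + 1), (x : ℂ) ^ (k - -(a : ℤ) - (N + (a + 1) : ℕ) + 1 : ℤ) =
      ((x : ℂ) ^ (N - k))⁻¹ := fun k hk => by
    have := Finset.mem_range.1 hk
    rw [← zpow_natCast, ← zpow_neg]
    congr 1
    omega
  refine ⟨fun s => ?_, fun s hs Θ hΘ => ?_, fun s _ hs Θ hΘ => ?_, fun s hs _ Θ hΘ => ?_,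
    fun s hs1 hs2 Θ hΘ => ?_⟩
  · rw [ea]
    obtain ⟨Θ, hΘ⟩ := exists_isMordellTornheim a s hx
    exact ⟨Θ, hΘ, fun Θ' hΘ' => hΘ'.unique hΘ⟩
  · rw [ea] at hΘ
    rw [hcen]
    have hs' : ∀ n : ℤ, s = n → (N : ℤ) + 1 < n ∧ n ≠ N + a + 2 := by
      rintro n rfl
      rcases hs with ⟨m, hm, h1, h2⟩ | h
      · have : n = m := by exact_mod_cast hm
        omega
      · exact absurd rfl (h n)
    refine (hΘ.isBigO_of_regular (N := N) hx (fun h => ?_) (fun k h => ?_)).congr_left fun t => ?_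
    · exact (hs' (N + a + 2) (by push_cast; linear_combination h)).2 rfl
    · have := (hs' (N + 1 - k) (by push_cast; linear_combination h)).1
      omega
    · rw [e1, e2, e3, e3, e5, leadCoeff_neg_natCast, Int.toNat_natCast, ea, sub_neg_eq_add,
        add_comm 1 (a : ℂ), Complex.Gamma_nat_eq_factorial]
      congr 2
      · rw [show s - a - 1 + -(N : ℂ) = s - (N + (a + 1) : ℕ) by push_cast; ring]
        ring
      · refine Finset.sum_congr rfl fun k hk => ?_
        rw [termCoeff_neg_natCast_of_le (Finset.mem_range_succ_iff.1 hk), e3, e6 k hk,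
          show (1 - -(a : ℤ) - (N + (a + 1) : ℕ) + k : ℤ) = k - -(a : ℤ) - (N + (a + 1) : ℕ) + 1 by
            ring, e7 k hk,
          show - -(a : ℂ) + s - (N + (a + 1) : ℕ) + k + 1 = s + k + -(N : ℂ) by push_cast; ring]
        field_simp
  · rw [ea] at hΘ
    rw [hcen]
    have hsc : (s : ℂ) = N + a + 2 := by rw [hs]; push_cast; ring
    refine (hΘ.isBigO_of_pole_lead hx hsc).congr_left fun t => ?_
    rw [e1, e2, e3, e3, e4, e4, e5, leadCoeff_neg_natCast, neg_neg, e3, ea, Int.toNat_natCast,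
      Int.toNat_natCast]
    congr 2
    · field_simp
      ring
    · refine Finset.sum_congr rfl fun k hk => ?_
      rw [termCoeff_neg_natCast_of_le (Finset.mem_range_succ_iff.1 hk), e7 k hk,
        show (s : ℂ) + k + -(N : ℂ) = k - -(a : ℂ) + 2 by rw [hsc]; ring,
        Nat.cast_choose ℂ (Finset.mem_range_succ_iff.1 hk)]
      field_simp
  · rw [ea] at hΘ
    rw [hcen]
    -- Here `s = -q`, and the pole belongs to the index `k = N + 1 + q`.
    obtain ⟨q, rfl⟩ : ∃ q : ℕ, s = -(q : ℤ) := ⟨s.natAbs, by omega⟩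
    have hsc : ((-(q : ℤ) : ℤ) : ℂ) = -(q : ℂ) := by push_cast; rfl
    refine (hΘ.isBigO_of_cancelled_pole (N := N) hx hsc).congr_left fun t => ?_
    rw [e1, e2, e3, e3, neg_neg, neg_neg, e3, e3, e5, ea, leadCoeff_neg_natCast,
      Int.toNat_natCast, show ((N + 1 : ℕ) : ℤ) - -(q : ℤ) = ((N + 1 + q : ℕ) : ℤ) by
        push_cast; ring, e3, hsc,
      show -(q : ℂ) - a - 1 + -(N : ℂ) = -(q : ℂ) - (N + (a + 1) : ℕ) by push_cast; ring,
      show -(a : ℂ) - (N + 1 + q : ℕ) = -(q : ℂ) - (N + (a + 1) : ℕ) by push_cast; ring,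
      show (-1 : ℂ) ^ (-(q : ℤ) - 1) = (-1) ^ (q + 1) by
        rw [show -(q : ℤ) - 1 = -((q + 1 : ℕ) : ℤ) by push_cast; ring, zpow_neg, zpow_natCast,
          ← inv_pow]
        norm_num, ← add_assoc]
    congr 3
    · ring
    · refine Finset.sum_congr rfl fun k hk => ?_
      rw [termCoeff_neg_natCast_of_le (Finset.mem_range_succ_iff.1 hk), e3, e6 k hk, e7 k hk,
        show -(q : ℂ) + 1 - -(a : ℂ) - (N + (a + 1) : ℕ) + k = -(q : ℂ) + k + -(N : ℂ) by
          push_cast; ring]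
      field_simp
  · rw [ea] at hΘ
    rw [hcen]
    rw [e1] at hs2
    -- The pole belongs to the index `k₀ = r + ℓ - s`.
    obtain ⟨k₀, hk₀, rfl⟩ : ∃ k₀ : ℕ, k₀ ≤ N ∧ s = N + 1 - k₀ :=
      ⟨(N + 1 - s).toNat, by omega, by omega⟩
    have hsc : (((N : ℤ) + 1 - k₀ : ℤ) : ℂ) = N + 1 - k₀ := by push_cast; rfl
    refine (hΘ.isBigO_of_pole hx hk₀ hsc).congr_left fun t => ?_
    have h1 : ((N + 1 : ℕ) : ℤ) - ((N : ℤ) + 1 - k₀) = (k₀ : ℤ) := by push_cast; ring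
    have h2 : (N : ℤ) + 1 - k₀ - 1 = ((N - k₀ : ℕ) : ℤ) := by omega
    have h3 : (-1 : ℂ) ^ (-(a : ℤ)) = (-1) ^ a := by
      rw [zpow_neg, zpow_natCast, ← inv_pow]
      norm_num
    have h4 : (Finset.range (N + 1)).filter (fun k : ℕ => (k : ℤ) ≠ (k₀ : ℤ)) =
        (Finset.range (N + 1)).filter (fun k => k ≠ k₀) := by
      simp only [ne_eq, Nat.cast_inj]
    have h5 : ∑ k ∈ (Finset.range (N + 1)).filter (fun k => k ≠ k₀),
          termCoeff a x k (-(N : ℂ)) * riemannZeta ((N : ℂ) + 1 - k₀ + k + -(N : ℂ)) =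
        ∑ k ∈ (Finset.range (N + 1)).filter (fun k => k ≠ k₀), (N.factorial : ℂ) *
          riemannZeta (-(a : ℂ) - k) / (factZ (((N + 1 : ℕ) : ℤ) - k - 1) *
          (x : ℂ) ^ (k - -(a : ℤ) - (N + (a + 1) : ℕ) + 1 : ℤ) * (k.factorial : ℂ)) *
          riemannZeta ((N : ℂ) + 1 - k₀ - -(a : ℂ) - (N + (a + 1) : ℕ) + k + 1) := by
      refine Finset.sum_congr rfl fun k hk' => ?_
      have hk := (Finset.mem_filter.1 hk').1
      rw [termCoeff_neg_natCast_of_le (Finset.mem_range_succ_iff.1 hk), e6 k hk, e7 k hk,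
        show (N : ℂ) + 1 - k₀ - -(a : ℂ) - (N + (a + 1) : ℕ) + k + 1 =
          (N : ℂ) + 1 - k₀ + k + -(N : ℂ) by push_cast; ring]
      field_simp
    simp only [e1, e2, e3, neg_neg, ea, h1, h2, h3, h4, hsc, e4, Int.toNat_natCast, zpow_natCast]
    rw [h5, leadCoeff_neg_natCast, termCoeff_neg_natCast_of_le hk₀,
      show -(a : ℂ) - k₀ = (N : ℂ) + 1 - k₀ - (N + (a + 1) : ℕ) by push_cast; ring,
      show (N : ℂ) + 1 - k₀ - a - 1 + -(N : ℂ) = (N : ℂ) + 1 - k₀ - (N + (a + 1) : ℕ) by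
        push_cast; ring]
    field_simp
    ring
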